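/- Conventions. All simplicial complexes are finite, abstract, and contain the empty face. For a complex $K$ on a finite vertex set $V$ put $d(K)=\dim K+1$, the largest cardinality of a face (so $d(\{\emptyset\})=0$). Let $f_{i-1}(K)$ be the number of faces with $i$ vertices; the $h$-vector of $K$ is $h_j(K)=\sum_{i=0}^{j}(-1)^{j-i}\binom{d(K)-i}{j-i}f_{i-1}(K)$, $0\le j\le d(K)$, and it is *symmetric* if $h_j(K)=h_{d(K)-j}(K)$ for all $0\le j\le d(K)$. Fix an integral domain $k$ (for instance $\mathbb Z$ or $\mathbb R$) as coefficients for homology. $K$ is *Gorenstein\** if it is pure and for every face $F\in K$ (including $F=\emptyset$) the link $\mathrm{lk}(F,K)$ has the same homology with coefficients in $k$ as a sphere of dimension $\dim \mathrm{lk}(F,K)$, i.e. its reduced homology is $k$ in that dimension and $0$ in all others (for the link $\{\emptyset\}$ this is the sphere of dimension $-1$). Let $A=\mathbb R[x_v:v\in V]$ with its degree grading, let $I_K\subset A$ be the ideal generated by the monomials whose support is not a face of $K$, and let $\mathbb R[K]=A/I_K$ be the face ring. A *linear system of parameters* (l.s.o.p.) of $\mathbb R[K]$ is a family $\Theta=(\theta_1,\dots,\theta_d)$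 of $d=d(K)$ linear forms $\theta_i\in A_1$ such that $H(K,\Theta)=\mathbb R[K]/(\Theta)$ is a finite-dimensional real vector space; $H(K,\Theta)$ is graded by degree. A linear form $\omega\in A_1$ is a *hard-Lefschetz (HL) element* of $H(K,\Theta)$ if multiplication by $\omega^{d-2i}$ is an isomorphism $H(K,\Theta)_i\to H(K,\Theta)_{d-i}$ for every integer $0\le i\le d/2$. The join of complexes $K$ and $L$ on disjoint vertex sets is $K*L=\{F\cup G: F\in K,\ G\in L\}$. Theorem. Let $K$ and $L$ be Gorenstein\* complexes on disjoint finite vertex sets, of dimensions $d_K-1$ and $d_L-1$, with l.s.o.p.'s $\Theta_K$, $\Theta_L$ of $\mathbb R[K]$, $\mathbb R[L]$ and HL elements $\omega_K$ of $H(K,\Theta_K)$ and $\omega_L$ of $H(L,\Theta_L)$. Then: (0) $K*L$ has a symmetric $h$-vector and dimension $d_K+d_L-1$; (1) the disjoint union $\Theta_K\uplus\Theta_L$ is an l.s.o.p. of $\mathbb R[K*L]$; (2) $\omega_K+\omega_L$ is an HL element of $\mathbb R[K*L]/(\Theta_K\uplus\Theta_L)$. -/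

import Mathlib

noncomputable section

/-- The quotient `Z / B` of a submodule `Z` by a submodule `B` (contained in `Z`). -/
abbrev Subquotient {k M : Type*} [CommRing k] [AddCommGroup M] [Module k M]
    (Z B : Submodule k M) : Type _ :=
  Z ⧸ B.submoduleOf Z

namespace PreAbstractSimplicialComplex

variable {V W : Type*}

/-- Faces in the combinatorial convention, in which the empty set is a face of every complex.
(In Mathlib's convention `s ∈ K` only for nonempty faces, so that `⊥` is the complex `{∅}`.) -/
def IsFace (K : PreAbstractSimplicialComplex V) (s : Finset V) : Prop :=
  s = ∅ ∨ s ∈ K.faces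

/-- `K.rank = dim K + 1`, the largest cardinality of a face of the finite complex `K`. -/
def rank (K : PreAbstractSimplicialComplex V) : ℕ :=
  sSup (Finset.card '' {s | K.IsFace s})

/-- The dimension of a finite complex; it is `-1` for the complex `{∅}`. -/
def dim (K : PreAbstractSimplicialComplex V) : ℤ :=
  (K.rank : ℤ) - 1

/-- All facets (inclusion-maximal faces) have the same dimension. -/
def IsPure (K : PreAbstractSimplicialComplex V) : Prop :=
  ∀ s, Maximal K.IsFace s → s.card = K.rank

/-- The link of `F`: all `G` disjoint from `F` such that `G ∪ F` is a face. -/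
def link (K : PreAbstractSimplicialComplex V) [DecidableEq V] (F : Finset V) :
    PreAbstractSimplicialComplex V where
  faces := {G | G.Nonempty ∧ Disjoint G F ∧ G ∪ F ∈ K.faces}
  isRelLowerSet_faces := by
    rintro G ⟨hG, hd, hm⟩
    refine ⟨hG, fun G' hle hne => ⟨hne, Finset.disjoint_of_subset_left hle hd, ?_⟩⟩
    exact (K.isRelLowerSet_faces hm).2 (Finset.union_subset_union_left hle)
      (hne.mono Finset.subset_union_left)

/-- The join `K * L` on the disjoint union of the vertex sets: its faces are the sets `F ⊎ G`
with `F` a (possibly empty) face of `K` and `G` a (possibly empty) face of `L`. -/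
def join (K : PreAbstractSimplicialComplex V) (L : PreAbstractSimplicialComplex W) :
    PreAbstractSimplicialComplex (V ⊕ W) where
  faces := {s | s.Nonempty ∧ K.IsFace s.toLeft ∧ L.IsFace s.toRight}
  isRelLowerSet_faces := by
    rintro s ⟨hs, hK, hL⟩
    refine ⟨hs, fun t hle hne => ⟨hne, ?_, ?_⟩⟩
    · have hsub : t.toLeft ⊆ s.toLeft := Finset.toLeft_subset_toLeft hle
      rcases t.toLeft.eq_empty_or_nonempty with h | h
      · exact Or.inl h
      · rcases hK with h0 | h0
        · exact Or.inl (Finset.subset_empty.mp (h0 ▸ hsub))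
        · exact Or.inr ((K.isRelLowerSet_faces h0).2 hsub h)
    · have hsub : t.toRight ⊆ s.toRight := Finset.toRight_subset_toRight hle
      rcases t.toRight.eq_empty_or_nonempty with h | h
      · exact Or.inl h
      · rcases hL with h0 | h0
        · exact Or.inl (Finset.subset_empty.mp (h0 ▸ hsub))
        · exact Or.inr ((L.isRelLowerSet_faces h0).2 hsub h)

/-! ### Reduced simplicial homology and homology spheres -/

section Homology

variable (k : Type*) [CommRing k] [LinearOrder V]

/-- The (augmented) simplicial boundary map on formal combinations of finite vertex sets,
`∂[v₀ < ⋯ < vₙ] = ∑ (-1)^i [v₀, …, v̂ᵢ, …, vₙ]`; in particular `∂[v] = [∅]` and `∂[∅] = 0`. -/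
def boundary : (Finset V →₀ k) →ₗ[k] (Finset V →₀ k) :=
  Finsupp.linearCombination k fun s : Finset V =>
    ∑ v ∈ s, (-1 : k) ^ (s.filter (· < v)).card • Finsupp.single (s.erase v) (1 : k)

/-- The chains spanned by the faces with `n` vertices, i.e. of dimension `n - 1`. -/
def chains (K : PreAbstractSimplicialComplex V) (n : ℕ) : Submodule k (Finset V →₀ k) :=
  Finsupp.supported k k {s | K.IsFace s ∧ s.card = n}

/-- The cycles of dimension `n - 1`. -/
def cycles (K : PreAbstractSimplicialComplex V) (n : ℕ) : Submodule k (Finset V →₀ k) :=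
  K.chains k n ⊓ LinearMap.ker (boundary k)

/-- The boundaries of dimension `n - 1`. -/
def boundaries (K : PreAbstractSimplicialComplex V) (n : ℕ) : Submodule k (Finset V →₀ k) :=
  (K.chains k (n + 1)).map (boundary k)

/-- The reduced simplicial homology of `K` in dimension `n - 1`, with coefficients in `k`. -/
abbrev ReducedHomology (K : PreAbstractSimplicialComplex V) (n : ℕ) : Type _ :=
  Subquotient (K.cycles k n) (K.boundaries k n)

/-- `K` has the same homology over `k` as a sphere of dimension `dim K`
(the sphere of dimension `-1` being empty). -/
def HasSphereHomology (K : PreAbstractSimplicialComplex V) : Prop :=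
  Nonempty (K.ReducedHomology k K.rank ≃ₗ[k] k) ∧
    ∀ n, n ≠ K.rank → Subsingleton (K.ReducedHomology k n)

/-- Gorenstein* complexes (homology spheres) with respect to coefficients in `k`: pure complexes
in which the link of every face, including the empty face, has the homology of a sphere of the
dimension of that link. -/
def IsGorensteinStar (K : PreAbstractSimplicialComplex V) : Prop :=
  K.IsPure ∧ ∀ F, K.IsFace F → (K.link F).HasSphereHomology k

end Homology

/-! ### The `h`-vector -/

/-- The number `f_{i-1}` of faces with `i` vertices. -/
def faceCount (K : PreAbstractSimplicialComplex V) (i : ℕ) : ℕ :=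
  {s | K.IsFace s ∧ s.card = i}.ncard

/-- `h_j = ∑_{i ≤ j} (-1)^{j-i} * C(d-i, j-i) * f_{i-1}` for `0 ≤ j ≤ d = dim K + 1`. -/
def hVector (K : PreAbstractSimplicialComplex V) (j : ℕ) : ℤ :=
  ∑ i ∈ Finset.range (j + 1),
    (-1) ^ (j - i) * ((K.rank - i).choose (j - i) : ℤ) * (K.faceCount i : ℤ)

/-- `h_j = h_{d-j}` for all `0 ≤ j ≤ d`. -/
def HasSymmetricHVector (K : PreAbstractSimplicialComplex V) : Prop :=
  ∀ j, j ≤ K.rank → K.hVector j = K.hVector (K.rank - j)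

/-! ### Face rings, linear systems of parameters and hard-Lefschetz elements over `ℝ` -/

/-- The ideal `I_K` generated by the monomials whose support is not a face. -/
def faceIdeal (K : PreAbstractSimplicialComplex V) : Ideal (MvPolynomial V ℝ) :=
  Ideal.span {p | ∃ m : V →₀ ℕ, ¬ K.IsFace m.support ∧ p = MvPolynomial.monomial m 1}

/-- The face ring `ℝ[K]`. -/
abbrev FaceRing (K : PreAbstractSimplicialComplex V) : Type _ :=
  MvPolynomial V ℝ ⧸ K.faceIdeal

/-- The ideal `(Θ)` of `ℝ[K]` generated by the images of the elements of `Θ`. -/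
def thetaIdeal (K : PreAbstractSimplicialComplex V) {ι : Type*} (Θ : ι → MvPolynomial V ℝ) :
    Ideal K.FaceRing :=
  Ideal.span (Set.range fun i => Ideal.Quotient.mk K.faceIdeal (Θ i))

/-- The quotient ring `H(K, Θ) = ℝ[K] / (Θ)`. -/
abbrev H (K : PreAbstractSimplicialComplex V) {ι : Type*} (Θ : ι → MvPolynomial V ℝ) : Type _ :=
  K.FaceRing ⧸ K.thetaIdeal Θ

/-- The projection of the polynomial ring onto `H(K, Θ)`. -/
def proj (K : PreAbstractSimplicialComplex V) {ι : Type*} (Θ : ι → MvPolynomial V ℝ) :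
    MvPolynomial V ℝ →ₐ[ℝ] K.H Θ :=
  (Ideal.Quotient.mkₐ ℝ (K.thetaIdeal Θ)).comp (Ideal.Quotient.mkₐ ℝ K.faceIdeal)

/-- The component `H(K, Θ)_i` for the grading induced by the degree of polynomials. -/
def degreePart (K : PreAbstractSimplicialComplex V) {ι : Type*} (Θ : ι → MvPolynomial V ℝ)
    (i : ℕ) : Submodule ℝ (K.H Θ) :=
  (MvPolynomial.homogeneousSubmodule V ℝ i).map (K.proj Θ).toLinearMap

/-- `Θ` is a linear system of parameters of `ℝ[K]`: it consists of `d = dim K + 1` linear forms,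
and `ℝ[K] / (Θ)` is a finite-dimensional real vector space. -/
def IsLSOP (K : PreAbstractSimplicialComplex V) {ι : Type*} (Θ : ι → MvPolynomial V ℝ) : Prop :=
  (∀ i, (Θ i).IsHomogeneous 1) ∧ Finite ι ∧ Nat.card ι = K.rank ∧ Module.Finite ℝ (K.H Θ)

/-- `ω` is a hard-Lefschetz element of `H(K, Θ)`: a linear form such that multiplication by
`ω ^ (d - 2i)` is an isomorphism `H(K, Θ)_i → H(K, Θ)_{d-i}` for all `0 ≤ i ≤ d / 2`. -/
def IsHLElement (K : PreAbstractSimplicialComplex V) {ι : Type*} (Θ : ι → MvPolynomial V ℝ)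
    (ω : MvPolynomial V ℝ) : Prop :=
  ω.IsHomogeneous 1 ∧ ∀ i, 2 * i ≤ K.rank →
    Set.BijOn (fun m : K.H Θ => K.proj Θ ω ^ (K.rank - 2 * i) * m)
      (K.degreePart Θ i) (K.degreePart Θ (K.rank - i))

end PreAbstractSimplicialComplex

/-- The disjoint union `Θ_K ⊎ Θ_L`, as a family of polynomials in both sets of variables. -/
def joinTheta {V W ι κ : Type*} (ΘK : ι → MvPolynomial V ℝ) (ΘL : κ → MvPolynomial W ℝ) :
    ι ⊕ κ → MvPolynomial (V ⊕ W) ℝ :=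
  Sum.elim (fun i => MvPolynomial.rename Sum.inl (ΘK i))
    (fun j => MvPolynomial.rename Sum.inr (ΘL j))

end

/-! Part (0) is enumerative. The links of a Gorenstein* complex satisfy the Euler relation of a
sphere, which gives the Dehn–Sommerville equations: the `h`-polynomial is palindromic
(`IsGorensteinStar.reflect_hPoly_eq`). Since `h`-polynomials multiply under joins (`hPoly_join`),
that of the join is palindromic too.

For (1) and (2), write `A`, `B`, `C` for the quotients attached to `K`, `L`, `K * L`. Morally `C = A
⊗ B` as graded algebras. It suffices to have a surjection `A ⊗ B → C` (`finite_join`, which proves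
(1)) and a surjection `C → A ⊗ B` (`finrank_mul_le_join`): the first bounds each graded dimension of
`C`, the second forces equality in total, so Hilbert polynomials multiply (`hilbertPoly_join`). A
Lefschetz element makes the Hilbert polynomial palindromic, hence so is that of `C`, and for (2)
only surjectivity of the Lefschetz maps remains.

By primitive decomposition (`gradedPart_le_span_strings`), `A` and `B` are spanned by strings `ω ^ j
* p`, so it is enough to treat a product of two strings. Such a product is an image of the tensor
product of two irreducible `sl₂`-representations, on which the raising operator corresponds to
multiplication by `ω_K + ω_L`. Surjectivity there (`string_mul_mem`) follows from the commutation
relations alone, by `sl2_mem_range_pow_raise`. -/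

/-! ### Lefschetz-type surjectivity from an `sl₂`-action -/

section Sl2

variable {M : Type*} [AddCommGroup M] [Module ℝ M]

/-- Moving `F` past `m + 1` copies of `E` collects the weights `2 * (n + i) - D` for `0 ≤ i ≤ m`,
whose sum is `(m + 1) * (2 * n - D + m)`. -/
theorem sl2_lower_pow_raise (X : ℕ → Submodule ℝ M) (E F : M →ₗ[ℝ] M) (D : ℕ)
    (hE : ∀ n, ∀ x ∈ X n, E x ∈ X (n + 1))
    (hEF : ∀ n, ∀ x ∈ X n, E (F x) - F (E x) = (2 * n - D : ℝ) • x)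
    (m n : ℕ) (x : M) (hx : x ∈ X n) :
    F ((E ^ (m + 1)) x) =
      (E ^ (m + 1)) (F x) - ((m + 1) * (2 * n - D + m) : ℝ) • (E ^ m) x := by
  have hpow : ∀ m, (E ^ m) x ∈ X (n + m) := by
    intro m
    induction m with
    | zero => simpa using hx
    | succ m ih => rw [pow_succ']; exact hE _ _ ih
  induction m with
  | zero =>
    have := hEF n x hx
    simp only [zero_add, pow_one, pow_zero, Module.End.one_apply, Nat.cast_zero, one_mul, add_zero]
    rw [← this]; abel
  | succ m ih =>
    have h1 := hEF (n + (m + 1)) _ (hpow (m + 1))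
    have h2 : (E ^ (m + 1 + 1)) x = E ((E ^ (m + 1)) x) := by rw [pow_succ']; rfl
    have h3 : (E ^ (m + 1 + 1)) (F x) = E ((E ^ (m + 1)) (F x)) := by rw [pow_succ']; rfl
    have h4 : (E ^ (m + 1)) x = E ((E ^ m) x) := by rw [pow_succ']; rfl
    rw [h2, h3, eq_sub_of_add_eq' (sub_eq_iff_eq_add.mp h1).symm, ih, map_sub, map_smul, ← h4]
    push_cast
    module

/-- This replaces the decomposition of a finite-dimensional representation into irreducibles. The
induction descends on `n` from degrees above `D`, where everything lies in `J`, and for fixed `n`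
ascends on `m`. -/
theorem sl2_mem_range_pow_raise (X : ℕ → Submodule ℝ M) (J : Submodule ℝ M) (E F : M →ₗ[ℝ] M)
    (D : ℕ) (hE : ∀ n, ∀ x ∈ X n, E x ∈ X (n + 1)) (hF : ∀ n, ∀ x ∈ X (n + 1), F x ∈ X n)
    (hF0 : ∀ x ∈ X 0, F x = 0)
    (hEF : ∀ n, ∀ x ∈ X n, E (F x) - F (E x) = (2 * n - D : ℝ) • x)
    (hJF : ∀ x ∈ J, F x ∈ J) (hXJ : ∀ n, D < n → X n ≤ J)
    (m n : ℕ) (hmn : m ≤ n) (hm : m + D ≤ 2 * n) (v : M) (hv : v ∈ X n) :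
    ∃ y ∈ X (n - m), v - (E ^ m) y ∈ J := by
  have hpow : ∀ m n x, x ∈ X n → (E ^ m) x ∈ X (n + m) := by
    intro m n x hx
    induction m with
    | zero => simpa using hx
    | succ m ih => rw [pow_succ']; exact hE _ _ ih
  obtain ⟨r, hr⟩ : ∃ r, D + 1 ≤ n + r := ⟨D + 1, by omega⟩
  induction r generalizing m n v with
  | zero => exact ⟨0, zero_mem _, by simpa using hXJ n (by omega) hv⟩
  | succ r ihr =>
    induction m with
    | zero => exact ⟨v, hv, by simp⟩
    | succ m ihm =>
      obtain ⟨x, hx, hj⟩ := ihm (by omega) (by omega)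
      have hx1 : (E ^ (m + 1)) x ∈ X (n + 1) := by
        have := hpow (m + 1) _ _ hx
        rwa [show n - m + (m + 1) = n + 1 by omega] at this
      -- The weight condition for `(m + 2, n + 1)` is that for `(m, n)`. Applying `F` to `E ^ (m +
      -- 1) x ≡ E ^ (m + 2) y` and commuting expresses a multiple `c` of `E ^ m x` through `E ^ (m +
      -- 1)`, modulo `J`.
      obtain ⟨y, hy, hj'⟩ := ihr (m + 2) (n + 1) (by omega) (by omega) _ hx1 (by omega)
      have hc1 := sl2_lower_pow_raise X E F D hE hEF m (n - m) x hx
      have hc2 := sl2_lower_pow_raise X E F D hE hEF (m + 1) _ y hy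
      have hy' : y ∈ X (n - (m + 1)) := by
        rwa [show n + 1 - (m + 2) = n - (m + 1) by omega] at hy
      have hFx : F x ∈ X (n - (m + 1)) :=
        hF _ _ (by rwa [show n - (m + 1) + 1 = n - m by omega])
      have hEFy : E (F y) ∈ X (n - (m + 1)) := by
        rcases h : n - (m + 1) with _ | l
        · rw [h] at hy'
          rw [hF0 y hy', map_zero]
          exact zero_mem _
        · rw [h] at hy'
          exact hE _ _ (hF _ _ hy')
      have hFj := hJF _ hj'
      rw [map_sub, hc1, hc2] at hFj
      set c : ℝ := (m + 1) * (2 * (n - m : ℕ) - D + m) with hc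
      -- Here `c = (m + 1) * (2 * n - m - D)`, positive because `m + 1 + D ≤ 2 * n`.
      have hc0 : c ≠ 0 := by
        rw [hc, Nat.cast_sub (by omega)]
        have : (m + 1 + D : ℝ) ≤ 2 * n := by exact_mod_cast hm
        have h0 : (0 : ℝ) ≤ m := Nat.cast_nonneg m
        have : (0 : ℝ) < (m + 1) * (2 * (n - m) - D + m) := mul_pos (by linarith) (by linarith)
        exact this.ne'
      set c' : ℝ := (((m + 1 : ℕ) : ℝ) + 1) * (2 * (n + 1 - (m + 2) : ℕ) - D + (m + 1 : ℕ))
        with hc'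
      refine ⟨c⁻¹ • (F x - E (F y) + c' • y),
        Submodule.smul_mem _ _ (add_mem (sub_mem hFx hEFy) (Submodule.smul_mem _ _ hy')), ?_⟩
      have e1 : (E ^ (m + 1 + 1)) (F y) = (E ^ (m + 1)) (E (F y)) := by rw [pow_succ]; rfl
      rw [e1] at hFj
      have : v - (E ^ (m + 1)) (c⁻¹ • (F x - E (F y) + c' • y)) = (v - (E ^ m) x)
          - c⁻¹ • ((E ^ (m + 1)) (F x) - c • (E ^ m) x
            - ((E ^ (m + 1)) (E (F y)) - c' • (E ^ (m + 1)) y)) := by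
        simp only [map_smul, map_add, map_sub, smul_sub, smul_add, smul_smul]
        rw [inv_mul_cancel₀ hc0, one_smul]
        abel
      rw [this]
      exact sub_mem hj (Submodule.smul_mem _ _ hFj)

end Sl2

/-! ### The product of two strings -/

section Strings

/-- The raising operator on the tensor product of two Verma modules with lowest weights `-μ` and
`-ν`, in the basis of monomials. -/
noncomputable def stringRaise : (ℕ × ℕ →₀ ℝ) →ₗ[ℝ] (ℕ × ℕ →₀ ℝ) :=
  Finsupp.linearCombination ℝ fun p =>
    Finsupp.single (p.1 + 1, p.2) 1 + Finsupp.single (p.1, p.2 + 1) 1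

/-- The lowering operator on the tensor product of two Verma modules. -/
noncomputable def stringLower (μ ν : ℕ) : (ℕ × ℕ →₀ ℝ) →ₗ[ℝ] (ℕ × ℕ →₀ ℝ) :=
  Finsupp.linearCombination ℝ fun p =>
    (p.1 * (μ - p.1 + 1) : ℝ) • Finsupp.single (p.1 - 1, p.2) 1 +
      (p.2 * (ν - p.2 + 1) : ℝ) • Finsupp.single (p.1, p.2 - 1) 1

theorem stringRaise_single (i j : ℕ) : stringRaise (Finsupp.single (i, j) 1) =
    Finsupp.single (i + 1, j) 1 + Finsupp.single (i, j + 1) 1 := by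
  simp [stringRaise]

theorem stringLower_single (μ ν i j : ℕ) : stringLower μ ν (Finsupp.single (i, j) 1) =
    (i * (μ - i + 1) : ℝ) • Finsupp.single (i - 1, j) 1 +
      (j * (ν - j + 1) : ℝ) • Finsupp.single (i, j - 1) 1 := by
  simp only [stringLower, Finsupp.linearCombination_single, one_smul]

theorem stringRaise_comm_stringLower (μ ν i j : ℕ) :
    stringRaise (stringLower μ ν (Finsupp.single (i, j) 1)) -
      stringLower μ ν (stringRaise (Finsupp.single (i, j) 1)) =
    (2 * (i + j : ℕ) - (μ + ν : ℕ) : ℝ) • Finsupp.single (i, j) (1 : ℝ) := by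
  simp only [stringRaise_single, stringLower_single, map_add, map_smul]
  -- The truncated `i - 1` at `i = 0` is harmless, as its coefficient has the factor `i`; splitting
  -- cases makes the indices match.
  rcases i with _ | i <;> rcases j with _ | j <;>
  · simp only [Nat.add_sub_cancel]
    push_cast
    module

theorem Finsupp.supported_le_of_single_mem {α : Type*} (s : Set α) (N : Submodule ℝ (α →₀ ℝ))
    (h : ∀ a ∈ s, Finsupp.single a 1 ∈ N) : Finsupp.supported ℝ ℝ s ≤ N := by
  rw [Finsupp.supported_eq_span_single, Submodule.span_le]
  rintro _ ⟨a, ha, rfl⟩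
  exact h a ha

/-- In a commutative algebra, let `P` be killed by `s ^ (μ + 1)` and `Q` by `t ^ (ν + 1)`. The
string products `s ^ i * t ^ j * P * Q` of nonnegative weight `k` are divisible by `(s + t) ^ k`. -/
theorem string_mul_mem {C : Type*} [CommRing C] [Algebra ℝ C] (s t P Q : C) (μ ν : ℕ)
    (hP : s ^ (μ + 1) * P = 0) (hQ : t ^ (ν + 1) * Q = 0) (N : Submodule ℝ C) (i j k : ℕ)
    (hk : 2 * (i + j) = μ + ν + k) (hi : i ≤ μ) (hj : j ≤ ν)
    (hN : ∀ a b, a + b + k = i + j → s ^ a * t ^ b * (P * Q) ∈ N) :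
    ∃ y ∈ N, s ^ i * t ^ j * (P * Q) = (s + t) ^ k * y := by
  let X : ℕ → Submodule ℝ (ℕ × ℕ →₀ ℝ) := fun n => Finsupp.supported ℝ ℝ {p | p.1 + p.2 = n}
  -- Modulo `J` the two Verma modules become irreducible, of dimensions `μ + 1` and `ν + 1`.
  let J : Submodule ℝ (ℕ × ℕ →₀ ℝ) := Finsupp.supported ℝ ℝ {p | μ < p.1 ∨ ν < p.2}
  have hXs : ∀ i j n, i + j = n → Finsupp.single (i, j) (1 : ℝ) ∈ X n := fun i j n h =>
    Finsupp.single_mem_supported ℝ _ h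
  have hJs : ∀ i j, (μ < i ∨ ν < j) → Finsupp.single (i, j) (1 : ℝ) ∈ J := fun i j h =>
    Finsupp.single_mem_supported ℝ _ h
  have hE : ∀ n, ∀ x ∈ X n, stringRaise x ∈ X (n + 1) := fun n =>
    Finsupp.supported_le_of_single_mem _ ((X (n + 1)).comap stringRaise) (by
      rintro ⟨i, j⟩ (h : i + j = n)
      rw [Submodule.mem_comap, stringRaise_single]
      exact add_mem (hXs _ _ _ (by omega)) (hXs _ _ _ (by omega)))
  have hF : ∀ n, ∀ x ∈ X (n + 1), stringLower μ ν x ∈ X n := fun n =>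
    Finsupp.supported_le_of_single_mem _ ((X n).comap (stringLower μ ν)) (by
      rintro ⟨i, j⟩ (h : i + j = n + 1)
      rw [Submodule.mem_comap, stringLower_single]
      refine add_mem ?_ ?_
      · rcases i with _ | i
        · simp
        · exact Submodule.smul_mem _ _ (hXs _ _ _ (by omega))
      · rcases j with _ | j
        · simp
        · exact Submodule.smul_mem _ _ (hXs _ _ _ (by omega)))
  have hF0 : ∀ x ∈ X 0, stringLower μ ν x = 0 :=
    Finsupp.supported_le_of_single_mem _ (LinearMap.ker (stringLower μ ν)) (by
      rintro ⟨i, j⟩ (h : i + j = 0)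
      obtain ⟨rfl, rfl⟩ : i = 0 ∧ j = 0 := by omega
      rw [LinearMap.mem_ker, stringLower_single]
      simp)
  have hEF : ∀ n, ∀ x ∈ X n, stringRaise (stringLower μ ν x) - stringLower μ ν (stringRaise x) =
      (2 * n - (μ + ν : ℕ) : ℝ) • x := fun n x hx => by
    have := Finsupp.supported_le_of_single_mem _ (LinearMap.ker
      (stringRaise ∘ₗ stringLower μ ν - stringLower μ ν ∘ₗ stringRaise -
        (2 * n - (μ + ν : ℕ) : ℝ) • LinearMap.id)) (by
      rintro ⟨i, j⟩ (h : i + j = n)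
      have := stringRaise_comm_stringLower μ ν i j
      rw [h] at this
      simpa [sub_eq_zero] using this) hx
    simpa [sub_eq_zero] using this
  have hJF : ∀ x ∈ J, stringLower μ ν x ∈ J :=
    Finsupp.supported_le_of_single_mem _ (J.comap (stringLower μ ν)) (by
      rintro ⟨i, j⟩ (h : μ < i ∨ ν < j)
      rw [Submodule.mem_comap, stringLower_single]
      refine add_mem ?_ ?_
      -- Lowering could leave the range `μ < i` only from `i = μ + 1`, where the coefficient `i * (μ
      -- - i + 1)` vanishes.
      · by_cases hi : i = μ + 1
        · subst hi; simp
        · exact Submodule.smul_mem _ _ (hJs _ _ (by omega))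
      · by_cases hj : j = ν + 1
        · subst hj; simp
        · exact Submodule.smul_mem _ _ (hJs _ _ (by omega)))
  have hXJ : ∀ n, μ + ν < n → X n ≤ J := fun n hn =>
    Finsupp.supported_le_of_single_mem _ _ (by
      rintro ⟨i, j⟩ (h : i + j = n)
      exact hJs _ _ (by omega))
  -- The required bound `k ≤ i + j` comes from `i ≤ μ` and `j ≤ ν`.
  obtain ⟨y, hy, hyJ⟩ := sl2_mem_range_pow_raise X J stringRaise (stringLower μ ν) (μ + ν) hE hF
    hF0 hEF hJF hXJ k (i + j) (by omega) (by omega) _ (hXs i j _ rfl)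
  -- No lowering operator is needed on `C`: `ρ` kills `J` and turns the raising operator into
  -- multiplication by `s + t`.
  let ρ : (ℕ × ℕ →₀ ℝ) →ₗ[ℝ] C :=
    Finsupp.linearCombination ℝ fun p => s ^ p.1 * t ^ p.2 * (P * Q)
  have hρs : ∀ i j, ρ (Finsupp.single (i, j) 1) = s ^ i * t ^ j * (P * Q) := fun i j => by
    simp [ρ]
  have hρJ : J ≤ LinearMap.ker ρ := Finsupp.supported_le_of_single_mem _ _ (by
    rintro ⟨i, j⟩ (h : μ < i ∨ ν < j)
    rw [LinearMap.mem_ker, hρs]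
    rcases h with h | h
    · obtain ⟨l, rfl⟩ := Nat.exists_eq_add_of_lt h
      linear_combination (s ^ l * t ^ j * Q) * hP
    · obtain ⟨l, rfl⟩ := Nat.exists_eq_add_of_lt h
      linear_combination (t ^ l * s ^ i * P) * hQ)
  have hρE : ∀ x, ρ (stringRaise x) = (s + t) * ρ x := fun x => by
    have : ρ ∘ₗ stringRaise = LinearMap.mulLeft ℝ (s + t) ∘ₗ ρ := by
      refine Finsupp.lhom_ext' fun ⟨i, j⟩ => LinearMap.ext_ring ?_
      simp only [LinearMap.comp_apply, Finsupp.lsingle_apply, LinearMap.mulLeft_apply,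
        stringRaise_single, map_add, hρs]
      ring
    exact LinearMap.congr_fun this x
  have hρEk : ∀ k x, ρ ((stringRaise ^ k) x) = (s + t) ^ k * ρ x := fun k x => by
    induction k with
    | zero => simp
    | succ k ih => rw [pow_succ', Module.End.mul_apply, hρE, ih]; ring
  refine ⟨ρ y, ?_, ?_⟩
  · refine Finsupp.supported_le_of_single_mem _ (N.comap ρ) ?_ hy
    rintro ⟨a, b⟩ (h : a + b = i + j - k)
    rw [Submodule.mem_comap, hρs]
    exact hN a b (by omega)
  · have := hρJ hyJ
    rw [LinearMap.mem_ker, map_sub, sub_eq_zero, hρEk, hρs] at this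
    exact this

end Strings

namespace PreAbstractSimplicialComplex

variable {V W : Type*}

/-! ### Faces and the rank -/

theorem IsFace.mono {K : PreAbstractSimplicialComplex V} {s t : Finset V} (ht : K.IsFace t)
    (hst : s ⊆ t) : K.IsFace s := by
  rcases s.eq_empty_or_nonempty with h | h
  · exact Or.inl h
  · rcases ht with h0 | h0
    · exact Or.inl (Finset.subset_empty.mp (h0 ▸ hst))
    · exact Or.inr ((K.isRelLowerSet_faces h0).2 hst h)

theorem isFace_empty (K : PreAbstractSimplicialComplex V) : K.IsFace ∅ := Or.inl rfl

theorem bddAbove_card_faces [Finite V] (K : PreAbstractSimplicialComplex V) :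
    BddAbove (Finset.card '' {s | K.IsFace s}) :=
  (Set.toFinite _).bddAbove

theorem IsFace.card_le_rank [Finite V] {K : PreAbstractSimplicialComplex V} {s : Finset V}
    (hs : K.IsFace s) : s.card ≤ K.rank :=
  le_csSup K.bddAbove_card_faces ⟨s, hs, rfl⟩

theorem exists_isFace_card_eq_rank [Finite V] (K : PreAbstractSimplicialComplex V) :
    ∃ s, K.IsFace s ∧ s.card = K.rank :=
  Nat.sSup_mem (s := Finset.card '' {s | K.IsFace s}) ⟨_, ∅, K.isFace_empty, rfl⟩
    K.bddAbove_card_faces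

theorem rank_eq_of_isFace [Finite V] {K : PreAbstractSimplicialComplex V} {n : ℕ}
    (h : ∀ s, K.IsFace s → s.card ≤ n) {s : Finset V} (hs : K.IsFace s) (hn : s.card = n) :
    K.rank = n := by
  obtain ⟨t, ht, htr⟩ := K.exists_isFace_card_eq_rank
  exact le_antisymm (htr ▸ h t ht) (hn ▸ hs.card_le_rank)

theorem isFace_join_iff (K : PreAbstractSimplicialComplex V) (L : PreAbstractSimplicialComplex W)
    (s : Finset (V ⊕ W)) : (K.join L).IsFace s ↔ K.IsFace s.toLeft ∧ L.IsFace s.toRight := by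
  constructor
  · rintro (rfl | h)
    · exact ⟨K.isFace_empty, L.isFace_empty⟩
    · exact h.2
  · intro h
    rcases s.eq_empty_or_nonempty with h0 | h0
    · exact Or.inl h0
    · exact Or.inr ⟨h0, h⟩

theorem rank_join [Finite V] [Finite W] (K : PreAbstractSimplicialComplex V)
    (L : PreAbstractSimplicialComplex W) : (K.join L).rank = K.rank + L.rank := by
  obtain ⟨s, hs, hsr⟩ := K.exists_isFace_card_eq_rank
  obtain ⟨t, ht, htr⟩ := L.exists_isFace_card_eq_rank
  refine rank_eq_of_isFace (s := s.disjSum t) (fun u hu => ?_) ?_ ?_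
  · rw [isFace_join_iff] at hu
    rw [← Finset.card_toLeft_add_card_toRight]
    exact add_le_add hu.1.card_le_rank hu.2.card_le_rank
  · rw [isFace_join_iff, Finset.toLeft_disjSum, Finset.toRight_disjSum]
    exact ⟨hs, ht⟩
  · rw [Finset.card_disjSum, hsr, htr]

theorem isFace_link_iff [DecidableEq V] {K : PreAbstractSimplicialComplex V} {F : Finset V}
    (hF : K.IsFace F) (G : Finset V) :
    (K.link F).IsFace G ↔ Disjoint G F ∧ K.IsFace (G ∪ F) := by
  constructor
  · rintro (rfl | h)
    · exact ⟨Finset.disjoint_empty_left F, by rwa [Finset.empty_union]⟩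
    · exact ⟨h.2.1, Or.inr h.2.2⟩
  · rintro ⟨hd, h⟩
    rcases G.eq_empty_or_nonempty with h0 | h0
    · exact Or.inl h0
    · refine Or.inr ⟨h0, hd, h.resolve_left fun h1 => ?_⟩
      exact h0.ne_empty (Finset.union_eq_empty.mp h1).1

theorem IsPure.rank_link [Finite V] [DecidableEq V] {K : PreAbstractSimplicialComplex V}
    (hK : K.IsPure) {F : Finset V} (hF : K.IsFace F) :
    (K.link F).rank = K.rank - F.card := by
  obtain ⟨M, hFM, hM⟩ := (Set.toFinite {s | K.IsFace s}).exists_le_maximal hF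
  refine rank_eq_of_isFace (s := M \ F) (fun G hG => ?_) ?_ ?_
  · rw [isFace_link_iff hF] at hG
    have := hG.2.card_le_rank
    rw [Finset.card_union_of_disjoint hG.1] at this
    omega
  · rw [isFace_link_iff hF]
    exact ⟨Finset.sdiff_disjoint, by rw [Finset.sdiff_union_of_subset hFM]; exact hM.1⟩
  · rw [Finset.card_sdiff_of_subset hFM, hK M hM]

/-- The finite set of all faces, including the empty one. -/
noncomputable def faceFinset [Fintype V] (K : PreAbstractSimplicialComplex V) : Finset (Finset V) := by
  classical exact Finset.univ.filter K.IsFace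

@[simp]
theorem mem_faceFinset [Fintype V] {K : PreAbstractSimplicialComplex V} {s : Finset V} :
    s ∈ K.faceFinset ↔ K.IsFace s := by
  simp [faceFinset]

theorem faceCount_eq_card [Fintype V] (K : PreAbstractSimplicialComplex V) (i : ℕ) :
    K.faceCount i = (K.faceFinset.filter fun s => s.card = i).card := by
  rw [faceCount, ← Set.ncard_coe_finset]
  congr 1
  ext s
  simp

theorem sum_faceFinset_card {R : Type*} [CommRing R] [Fintype V]
    (K : PreAbstractSimplicialComplex V) {N : ℕ} (hN : K.rank ≤ N) (g : ℕ → R) :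
    ∑ s ∈ K.faceFinset, g s.card = ∑ i ∈ Finset.range (N + 1), (K.faceCount i : R) * g i := by
  rw [← Finset.sum_fiberwise_of_maps_to (s := K.faceFinset) (t := Finset.range (N + 1))
    (g := Finset.card) (fun s hs => Finset.mem_range.mpr
      (Nat.lt_succ_of_le ((mem_faceFinset.mp hs).card_le_rank.trans hN)))]
  refine Finset.sum_congr rfl fun i _ => ?_
  rw [Finset.sum_congr rfl (g := fun _ => g i) fun s hs => by rw [(Finset.mem_filter.mp hs).2],
    Finset.sum_const, faceCount_eq_card, nsmul_eq_mul]

/-! ### The Euler characteristic -/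

section Euler

variable (k : Type*) [CommRing k]

theorem finrank_chains [IsDomain k] [Finite V] (K : PreAbstractSimplicialComplex V) (n : ℕ) :
    Module.finrank k (K.chains k n) = K.faceCount n := by
  classical
  have := Fintype.ofFinite {s | K.IsFace s ∧ s.card = n}
  refine (Finsupp.supportedEquivFinsupp (R := k) (M := k)
    {s | K.IsFace s ∧ s.card = n}).finrank_eq.trans ?_
  rw [Module.finrank_finsupp_self, faceCount, ← Nat.card_coe_set_eq, Nat.card_eq_fintype_card]

variable [LinearOrder V]

theorem boundary_single (s : Finset V) : boundary k (Finsupp.single s 1) =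
    ∑ v ∈ s, (-1 : k) ^ (s.filter (· < v)).card • Finsupp.single (s.erase v) (1 : k) := by
  rw [boundary, Finsupp.linearCombination_single, one_smul]

/-- For `w < v`, deleting `w` first shifts the position of `v` by one, while deleting `v` first
leaves that of `w` unchanged. -/
theorem neg_one_pow_erase_swap {s : Finset V} {v w : V} (hv : v ∈ s) (hw : w ∈ s) (hvw : v ≠ w) :
    (-1 : k) ^ (s.filter (· < v)).card * (-1) ^ ((s.erase v).filter (· < w)).card +
      (-1 : k) ^ (s.filter (· < w)).card * (-1) ^ ((s.erase w).filter (· < v)).card = 0 := by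
  wlog h : w < v generalizing v w
  · rw [add_comm]
    exact this hw hv hvw.symm (lt_of_le_of_ne (not_lt.mp h) hvw)
  have h1 : (s.erase v).filter (· < w) = s.filter (· < w) := by
    rw [Finset.filter_erase, Finset.erase_eq_of_notMem]
    simp [h.le]
  have h2 : ((s.erase w).filter (· < v)).card + 1 = (s.filter (· < v)).card := by
    rw [Finset.filter_erase, Finset.card_erase_add_one]
    simp [hw, h]
  rw [h1, ← h2, pow_succ]
  ring

theorem boundary_boundary (x : Finset V →₀ k) : boundary k (boundary k x) = 0 := by
  have : boundary k ∘ₗ boundary k = (0 : (Finset V →₀ k) →ₗ[k] _) := by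
    refine Finsupp.lhom_ext' fun s => LinearMap.ext_ring ?_
    simp only [LinearMap.comp_apply, Finsupp.lsingle_apply, boundary_single, map_sum, map_smul,
      Finset.smul_sum, smul_smul, LinearMap.zero_apply]
    rw [Finset.sum_sigma']
    refine Finset.sum_involution (fun p _ => ⟨p.2, p.1⟩) ?_ ?_ ?_ ?_
    · rintro ⟨v, w⟩ h
      simp only [Finset.mem_sigma, Finset.mem_erase] at h
      simp only
      rw [Finset.erase_right_comm, ← add_smul,
        neg_one_pow_erase_swap k h.1 h.2.2 (Ne.symm h.2.1), zero_smul]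
    · rintro ⟨v, w⟩ h _ he
      simp only [Finset.mem_sigma, Finset.mem_erase] at h
      simp only [Sigma.mk.injEq] at he
      exact h.2.1 he.1
    · rintro ⟨v, w⟩ h
      simp only [Finset.mem_sigma, Finset.mem_erase] at h ⊢
      exact ⟨h.2.2, Ne.symm h.2.1, h.1⟩
    · rintro ⟨v, w⟩ _
      rfl
  exact LinearMap.congr_fun this x

theorem boundary_mem_chains {K : PreAbstractSimplicialComplex V} {n : ℕ} {x : Finset V →₀ k}
    (hx : x ∈ K.chains k (n + 1)) : boundary k x ∈ K.chains k n := by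
  have : K.chains k (n + 1) ≤ (K.chains k n).comap (boundary k) := by
    rw [chains, Finsupp.supported_eq_span_single, Submodule.span_le]
    rintro _ ⟨s, ⟨hs, hc⟩, rfl⟩
    rw [SetLike.mem_coe, Submodule.mem_comap, boundary_single]
    refine sum_mem fun v hv => Submodule.smul_mem _ _ (Finsupp.single_mem_supported k _ ?_)
    exact ⟨hs.mono (Finset.erase_subset _ _), by rw [Finset.card_erase_of_mem hv, hc]; rfl⟩
  exact this hx

theorem boundaries_le_cycles (K : PreAbstractSimplicialComplex V) (n : ℕ) :
    K.boundaries k n ≤ K.cycles k n := by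
  rintro _ ⟨x, hx, rfl⟩
  exact ⟨boundary_mem_chains k hx, boundary_boundary k x⟩

theorem cycles_zero (K : PreAbstractSimplicialComplex V) : K.cycles k 0 = K.chains k 0 := by
  refine inf_eq_left.mpr ?_
  rw [chains, Finsupp.supported_eq_span_single, Submodule.span_le]
  rintro _ ⟨s, ⟨-, hc⟩, rfl⟩
  rw [Finset.card_eq_zero.mp hc, SetLike.mem_coe, LinearMap.mem_ker, boundary_single,
    Finset.sum_empty]

variable [IsDomain k] [Finite V]

/-- Homology need not be free, but rank is additive over a domain. Additivity is known for
cardinals, so finiteness of the rank of the quotient is checked before passing to `ℕ`. -/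
theorem finrank_reducedHomology_add (K : PreAbstractSimplicialComplex V) (n : ℕ) :
    Module.finrank k (K.ReducedHomology k n) + Module.finrank k (K.boundaries k n) =
      Module.finrank k (K.cycles k n) := by
  have hr := HasRankNullity.rank_quotient_add_rank (R := k) (M := K.cycles k n)
    ((K.boundaries k n).submoduleOf (K.cycles k n))
  rw [(Submodule.submoduleOfEquivOfLe (K.boundaries_le_cycles k n)).rank_eq,
    ← Submodule.finrank_eq_rank, ← Submodule.finrank_eq_rank] at hr
  have hlt : Module.rank k (K.ReducedHomology k n) < Cardinal.aleph0 :=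
    lt_of_le_of_lt (le_self_add.trans hr.le) (Cardinal.natCast_lt_aleph0)
  have := congrArg Cardinal.toNat hr
  rwa [Cardinal.toNat_add hlt Cardinal.natCast_lt_aleph0, Cardinal.toNat_natCast,
    Cardinal.toNat_natCast] at this

theorem finrank_boundaries_add (K : PreAbstractSimplicialComplex V) (n : ℕ) :
    Module.finrank k (K.boundaries k n) + Module.finrank k (K.cycles k (n + 1)) =
      K.faceCount (n + 1) := by
  have hr := LinearMap.rank_range_add_rank_ker (R := k) (M := K.chains k (n + 1))
    (M₁ := Finset V →₀ k) ((boundary k).domRestrict (K.chains k (n + 1)))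
  have e1 : LinearMap.range ((boundary k).domRestrict (K.chains k (n + 1))) = K.boundaries k n :=
    LinearMap.range_domRestrict _ _
  have e2 : LinearMap.ker ((boundary k).domRestrict (K.chains k (n + 1))) =
      (K.cycles k (n + 1)).submoduleOf (K.chains k (n + 1)) := by
    ext x
    simp [cycles, Submodule.submoduleOf]
  rw [e1, e2, (Submodule.submoduleOfEquivOfLe (p := K.cycles k (n + 1)) inf_le_left).rank_eq,
    ← Submodule.finrank_eq_rank, ← Submodule.finrank_eq_rank, ← Submodule.finrank_eq_rank,
    finrank_chains] at hr
  exact_mod_cast hr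

/-- Truncated Euler–Poincaré formula: the sum telescopes, leaving the boundaries that come from
faces with `N + 1` vertices. -/
theorem sum_faceCount_eq (K : PreAbstractSimplicialComplex V) (N : ℕ) :
    ∑ n ∈ Finset.range (N + 1), (K.faceCount n : ℤ) * (-1) ^ n =
      ∑ n ∈ Finset.range (N + 1), (Module.finrank k (K.ReducedHomology k n) : ℤ) * (-1) ^ n +
        (-1) ^ N * Module.finrank k (K.boundaries k N) := by
  induction N with
  | zero =>
    have h := K.finrank_reducedHomology_add k 0
    have h0 : Module.finrank k (K.cycles k 0) = K.faceCount 0 := by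
      rw [cycles_zero, finrank_chains]
    rw [h0] at h
    simp only [zero_add, Finset.sum_range_one, pow_zero, mul_one, one_mul]
    exact_mod_cast h.symm
  | succ N ih =>
    have h1 : (_ : ℤ) = _ := congrArg Nat.cast (K.finrank_boundaries_add k N)
    have h2 : (_ : ℤ) = _ := congrArg Nat.cast (K.finrank_reducedHomology_add k (N + 1))
    push_cast at h1 h2
    rw [Finset.sum_range_succ, ih, Finset.sum_range_succ _ (N + 1), ← h1, ← h2]
    ring

theorem HasSphereHomology.sum_neg_one_pow [Fintype V] {K : PreAbstractSimplicialComplex V}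
    (hK : K.HasSphereHomology k) :
    ∑ s ∈ K.faceFinset, (-1 : ℤ) ^ s.card = (-1) ^ K.rank := by
  have hb : K.boundaries k K.rank = ⊥ := by
    have : K.chains k (K.rank + 1) = ⊥ := by
      rw [chains, Finsupp.supported_eq_span_single, Submodule.span_eq_bot]
      rintro _ ⟨s, ⟨hs, hc⟩, rfl⟩
      have := hs.card_le_rank
      omega
    rw [boundaries, this, Submodule.map_bot]
  rw [sum_faceFinset_card K le_rfl (fun n => (-1 : ℤ) ^ n), sum_faceCount_eq k, hb, finrank_bot,
    Nat.cast_zero, mul_zero, add_zero, Finset.sum_eq_single K.rank]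
  · rw [hK.1.some.finrank_eq, Module.finrank_self, Nat.cast_one, one_mul]
  · intro n _ hn
    have := hK.2 n hn
    rw [Module.finrank_zero_of_subsingleton, Nat.cast_zero, zero_mul]
  · intro h
    exact absurd (Finset.mem_range.mpr (Nat.lt_succ_self _)) h

/-- Removing `F` identifies the faces containing `F` with those of its link, whose rank is `K.rank -
F.card` by purity. -/
theorem IsGorensteinStar.sum_neg_one_pow [Fintype V] {K : PreAbstractSimplicialComplex V}
    (hK : K.IsGorensteinStar k) {F : Finset V} (hF : K.IsFace F) :
    ∑ s ∈ K.faceFinset.filter (F ⊆ ·), (-1 : ℤ) ^ s.card = (-1) ^ K.rank := by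
  have h := (hK.2 F hF).sum_neg_one_pow
  rw [hK.1.rank_link hF] at h
  have hc : K.rank = F.card + (K.rank - F.card) := by
    have := hF.card_le_rank
    omega
  rw [hc, pow_add, ← h, Finset.mul_sum]
  refine Finset.sum_nbij' (fun s => s \ F) (fun G => G ∪ F) ?_ ?_ ?_ ?_ ?_
  · intro s hs
    rw [Finset.mem_filter, mem_faceFinset] at hs
    rw [mem_faceFinset, isFace_link_iff hF, Finset.sdiff_union_of_subset hs.2]
    exact ⟨Finset.sdiff_disjoint, hs.1⟩
  · intro G hG
    rw [mem_faceFinset, isFace_link_iff hF] at hG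
    rw [Finset.mem_filter, mem_faceFinset]
    exact ⟨hG.2, Finset.subset_union_right⟩
  · intro s hs
    exact Finset.sdiff_union_of_subset (Finset.mem_filter.mp hs).2
  · intro G hG
    rw [mem_faceFinset, isFace_link_iff hF] at hG
    exact Finset.union_sdiff_cancel_right hG.1
  · intro s hs
    rw [← pow_add, ← Finset.card_sdiff_add_card_eq_card (Finset.mem_filter.mp hs).2, add_comm]

end Euler

/-! ### The `h`-polynomial -/

section HPoly

open Polynomial

/-- The `h`-polynomial `∑ F, X ^ |F| * (1 - X) ^ (d - |F|)`. -/
noncomputable def hPoly [Fintype V] (K : PreAbstractSimplicialComplex V) : ℤ[X] :=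
  ∑ s ∈ K.faceFinset, X ^ s.card * (1 - X) ^ (K.rank - s.card)

theorem coeff_one_sub_X_pow (n j : ℕ) :
    ((1 - X : ℤ[X]) ^ n).coeff j = (-1) ^ j * (n.choose j : ℤ) := by
  have : (1 - X : ℤ[X]) ^ n = ((1 + X : ℤ[X]) ^ n).comp (C (-1) * X) := by
    simp [sub_eq_add_neg]
  rw [this, comp_C_mul_X_coeff, coeff_one_add_X_pow, mul_comm]

theorem coeff_hPoly [Fintype V] (K : PreAbstractSimplicialComplex V) {j : ℕ} (hj : j ≤ K.rank) :
    K.hPoly.coeff j = K.hVector j := by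
  rw [hPoly, K.sum_faceFinset_card le_rfl (fun i => (X : ℤ[X]) ^ i * (1 - X) ^ (K.rank - i)),
    finsetSum_coeff, hVector]
  symm
  refine Finset.sum_subset_zero_on_sdiff (Finset.range_subset_range.mpr (by omega)) ?_ ?_
  · intro i hi
    rw [Finset.mem_sdiff, Finset.mem_range, Finset.mem_range] at hi
    rw [← C_eq_natCast, coeff_C_mul, coeff_X_pow_mul', if_neg (by omega), mul_zero]
  · intro i hi
    rw [Finset.mem_range] at hi
    rw [← C_eq_natCast, coeff_C_mul, coeff_X_pow_mul', if_pos (by omega), coeff_one_sub_X_pow]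
    ring

theorem natDegree_one_sub_X_pow_le (n : ℕ) : ((1 - X : ℤ[X]) ^ n).natDegree ≤ n := by
  refine (natDegree_pow_le).trans ?_
  have : (1 - X : ℤ[X]).natDegree ≤ 1 := by
    refine (natDegree_sub_le _ _).trans ?_
    simp
  simpa using Nat.mul_le_mul_left n this

theorem reflect_one_sub_X_pow (n : ℕ) : reflect n ((1 - X : ℤ[X]) ^ n) = (X - 1) ^ n := by
  induction n with
  | zero => simp
  | succ n ih =>
    have h1 : (1 - X : ℤ[X]).natDegree ≤ 1 := by
      simpa using natDegree_one_sub_X_pow_le 1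
    rw [pow_succ, reflect_mul _ _ (natDegree_one_sub_X_pow_le n) h1, ih, reflect_sub,
      reflect_one_X, reflect_one, pow_one, pow_succ]

theorem natDegree_hPoly_le [Fintype V] (K : PreAbstractSimplicialComplex V) :
    K.hPoly.natDegree ≤ K.rank := by
  refine natDegree_sum_le_of_forall_le _ _ fun s hs => ?_
  have := (mem_faceFinset.mp hs).card_le_rank
  refine natDegree_mul_le.trans ?_
  rw [natDegree_X_pow]
  have := natDegree_one_sub_X_pow_le (K.rank - s.card)
  omega

theorem reflect_hPoly [Fintype V] (K : PreAbstractSimplicialComplex V) :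
    reflect K.rank K.hPoly = ∑ s ∈ K.faceFinset, (X - 1) ^ (K.rank - s.card) := by
  have : ∀ f : Finset V → ℤ[X], reflect K.rank (∑ s ∈ K.faceFinset, f s) =
      ∑ s ∈ K.faceFinset, reflect K.rank (f s) := fun f =>
    map_sum ({ toFun := reflect K.rank, map_zero' := reflect_zero,
               map_add' := fun a b => reflect_add a b _ } : ℤ[X] →+ ℤ[X]) f _
  rw [hPoly, this]
  refine Finset.sum_congr rfl fun s hs => ?_
  have hs' := (mem_faceFinset.mp hs).card_le_rank
  have h := reflect_mul (X ^ s.card : ℤ[X]) ((1 - X) ^ (K.rank - s.card)) (F := s.card)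
    (natDegree_X_pow s.card).le (natDegree_one_sub_X_pow_le _)
  rw [Nat.add_sub_cancel' hs'] at h
  rw [h, reflect_one_sub_X_pow, reflect_monomial, revAt_le le_rfl, Nat.sub_self, pow_zero, one_mul]

/-- Dehn–Sommerville: multiply the `F`-term by `1 = ∑_{G ⊇ F} (-1) ^ (d - |G|)` and exchange the
sums. For fixed `G` the sum over `F ⊆ G` is the binomial expansion of `(X + (1 - X)) ^ |G| = 1`. -/
theorem IsGorensteinStar.reflect_hPoly_eq (k : Type*) [CommRing k] [IsDomain k] [LinearOrder V]
    [Fintype V] {K : PreAbstractSimplicialComplex V} (hK : K.IsGorensteinStar k) :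
    reflect K.rank K.hPoly = K.hPoly := by
  have h1 : ∀ F ∈ K.faceFinset, (X : ℤ[X]) ^ F.card * (1 - X) ^ (K.rank - F.card) =
      ∑ G ∈ K.faceFinset.filter (F ⊆ ·), (-1 : ℤ[X]) ^ (K.rank - G.card) *
        (X ^ F.card * (1 - X) ^ (K.rank - F.card)) := by
    intro F hF
    have h := hK.sum_neg_one_pow k (mem_faceFinset.mp hF)
    rw [← Finset.sum_mul]
    have h' : ∑ G ∈ K.faceFinset.filter (F ⊆ ·), (-1 : ℤ[X]) ^ (K.rank - G.card) = 1 := by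
      have h2 := congrArg (fun z : ℤ => (-1 : ℤ[X]) ^ K.rank * (z : ℤ[X])) h
      simp only [Int.cast_sum, Int.cast_pow, Int.cast_neg, Int.cast_one, Finset.mul_sum] at h2
      rw [← mul_pow, neg_one_mul, neg_neg, one_pow] at h2
      refine Eq.trans ?_ h2
      refine Finset.sum_congr rfl fun G hG => ?_
      have := (mem_faceFinset.mp (Finset.mem_filter.mp hG).1).card_le_rank
      conv_rhs => rw [← Nat.sub_add_cancel this, pow_add, mul_assoc, ← mul_pow]
      simp
    rw [h', one_mul]
  rw [reflect_hPoly, hPoly, Finset.sum_congr rfl h1, Finset.sum_comm' (t' := K.faceFinset)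
    (s' := fun G => G.powerset)]
  · refine Finset.sum_congr rfl fun G hG => ?_
    have hG' := (mem_faceFinset.mp hG).card_le_rank
    have h2 : ∀ F ∈ G.powerset, (-1 : ℤ[X]) ^ (K.rank - G.card) *
        (X ^ F.card * (1 - X) ^ (K.rank - F.card)) =
        (X - 1) ^ (K.rank - G.card) * (X ^ F.card * (1 - X) ^ (G.card - F.card)) := by
      intro F hF
      have := Finset.card_le_card (Finset.mem_powerset.mp hF)
      rw [show K.rank - F.card = (K.rank - G.card) + (G.card - F.card) by omega, pow_add,
        show (X - 1 : ℤ[X]) = -1 * (1 - X) by ring, mul_pow]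
      ring
    rw [Finset.sum_congr rfl h2, ← Finset.mul_sum, Finset.sum_pow_mul_eq_add_pow]
    simp
  · intro F G
    simp only [mem_faceFinset, Finset.mem_filter, Finset.mem_powerset]
    exact ⟨fun h => ⟨h.2.2, h.2.1⟩, fun h => ⟨h.2.mono h.1, h.2, h.1⟩⟩

theorem hPoly_join [Fintype V] [Fintype W] (K : PreAbstractSimplicialComplex V)
    (L : PreAbstractSimplicialComplex W) : (K.join L).hPoly = K.hPoly * L.hPoly := by
  rw [hPoly, hPoly, hPoly, Finset.sum_mul_sum, ← Finset.sum_product']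
  refine Finset.sum_nbij' (fun s => (s.toLeft, s.toRight)) (fun p => p.1.disjSum p.2) ?_ ?_ ?_ ?_ ?_
  · intro s hs
    rw [mem_faceFinset, isFace_join_iff] at hs
    simpa using hs
  · intro p hp
    rw [Finset.mem_product, mem_faceFinset, mem_faceFinset] at hp
    rw [mem_faceFinset, isFace_join_iff, Finset.toLeft_disjSum, Finset.toRight_disjSum]
    exact hp
  · intro s _
    exact Finset.toLeft_disjSum_toRight
  · intro p _
    simp
  · intro s hs
    rw [mem_faceFinset, isFace_join_iff] at hs
    have h1 := hs.1.card_le_rank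
    have h2 := hs.2.card_le_rank
    rw [rank_join, ← Finset.card_toLeft_add_card_toRight, pow_add,
      show K.rank + L.rank - (s.toLeft.card + s.toRight.card) =
        (K.rank - s.toLeft.card) + (L.rank - s.toRight.card) by omega, pow_add]
    ring

theorem IsGorensteinStar.hasSymmetricHVector_join (k : Type*) [CommRing k] [IsDomain k]
    [LinearOrder V] [Finite V] [LinearOrder W] [Finite W] {K : PreAbstractSimplicialComplex V}
    {L : PreAbstractSimplicialComplex W} (hK : K.IsGorensteinStar k) (hL : L.IsGorensteinStar k) :
    (K.join L).HasSymmetricHVector := by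
  have := Fintype.ofFinite V
  have := Fintype.ofFinite W
  intro j hj
  rw [← coeff_hPoly _ hj, ← coeff_hPoly _ (Nat.sub_le _ _), ← revAt_le hj, ← coeff_reflect,
    hPoly_join, rank_join, reflect_mul _ _ K.natDegree_hPoly_le L.natDegree_hPoly_le,
    hK.reflect_hPoly_eq, hL.reflect_hPoly_eq]

end HPoly

end PreAbstractSimplicialComplex

/-! ### Homogeneous polynomials and graded parts -/

open MvPolynomial in
theorem MvPolynomial.homogeneousSubmodule_le_of_monomial_mem {σ : Type*} {n : ℕ}
    {N : Submodule ℝ (MvPolynomial σ ℝ)} (h : ∀ m : σ →₀ ℕ, m.degree = n → monomial m 1 ∈ N) :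
    homogeneousSubmodule σ ℝ n ≤ N := by
  intro p hp
  rw [p.as_sum]
  refine sum_mem fun m hm => ?_
  have hd : m.degree = n := by
    rw [Finsupp.degree_eq_weight_one]
    exact hp (mem_support_iff.mp hm)
  rw [← mul_one (coeff m p), ← smul_eq_mul, ← smul_monomial]
  exact N.smul_mem _ (h m hd)

theorem Finsupp.exists_eq_single_of_degree_eq_one {σ : Type*} {m : σ →₀ ℕ} (h : m.degree = 1) :
    ∃ v, m = Finsupp.single v 1 := by
  have hne : m ≠ 0 := by
    rintro rfl
    simp at h
  obtain ⟨v, hv⟩ := Finsupp.ne_iff.mp hne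
  have hle : Finsupp.single v 1 ≤ m := Finsupp.single_le_iff.mpr (Nat.one_le_iff_ne_zero.mpr hv)
  obtain ⟨m', rfl⟩ := exists_add_of_le hle
  rw [map_add, Finsupp.degree_single, Nat.add_eq_left, Finsupp.degree_eq_zero_iff] at h
  exact ⟨v, by rw [h, add_zero]⟩

open MvPolynomial in
theorem MvPolynomial.homogeneousSubmodule_one_le_of_X_mem {σ : Type*}
    {N : Submodule ℝ (MvPolynomial σ ℝ)} (h : ∀ v, X v ∈ N) :
    homogeneousSubmodule σ ℝ 1 ≤ N :=
  homogeneousSubmodule_le_of_monomial_mem fun m hm => by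
    obtain ⟨v, rfl⟩ := Finsupp.exists_eq_single_of_degree_eq_one hm
    exact h v

/-- Evaluation along the line through the point `g`: the power of the parameter records the degree.
-/
theorem MvPolynomial.aeval_C_mul_X_of_isHomogeneous {σ B : Type*} [CommRing B] [Algebra ℝ B]
    (g : σ → B) {n : ℕ} {p : MvPolynomial σ ℝ} (hp : p.IsHomogeneous n) :
    aeval (fun v => Polynomial.C (g v) * Polynomial.X) p =
      Polynomial.C (aeval g p) * Polynomial.X ^ n := by
  have h := homogeneousSubmodule_le_of_monomial_mem (n := n)
    (N := LinearMap.eqLocus (aeval fun v => Polynomial.C (g v) * Polynomial.X).toLinearMap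
      (LinearMap.mulRight ℝ (Polynomial.X ^ n) ∘ₗ
        (Polynomial.CAlgHom (R := ℝ) (A := B)).toLinearMap ∘ₗ (aeval g).toLinearMap)) (by
    rintro m rfl
    simp only [LinearMap.mem_eqLocus, AlgHom.toLinearMap_apply, LinearMap.comp_apply,
      LinearMap.mulRight_apply, Polynomial.CAlgHom_apply, aeval_monomial, map_one, one_mul,
      mul_pow, Finsupp.prod, map_prod, map_pow, Finsupp.degree_apply]
    rw [Finset.prod_mul_distrib, Finset.prod_pow_eq_pow_sum])
  exact h hp

namespace MvPolynomial

/-- The degree `n` part of the target of a map from a polynomial ring. -/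
noncomputable def gradedPart {σ A : Type*} [CommRing A] [Algebra ℝ A] (π : MvPolynomial σ ℝ →ₐ[ℝ] A) (n : ℕ) :
    Submodule ℝ A :=
  (homogeneousSubmodule σ ℝ n).map π.toLinearMap

section GradedPart

variable {σ A : Type*} [CommRing A] [Algebra ℝ A] (π : MvPolynomial σ ℝ →ₐ[ℝ] A)

theorem map_mem_gradedPart {p : MvPolynomial σ ℝ} {n : ℕ} (hp : p.IsHomogeneous n) :
    π p ∈ gradedPart π n :=
  ⟨p, hp, rfl⟩

variable {π}

theorem mul_mem_gradedPart {x y : A} {i j : ℕ} (hx : x ∈ gradedPart π i)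
    (hy : y ∈ gradedPart π j) : x * y ∈ gradedPart π (i + j) := by
  obtain ⟨p, hp, rfl⟩ := hx
  obtain ⟨q, hq, rfl⟩ := hy
  exact ⟨p * q, hp.mul hq, map_mul π _ _⟩

theorem pow_mem_gradedPart {x : A} (hx : x ∈ gradedPart π 1) (n : ℕ) :
    x ^ n ∈ gradedPart π n := by
  obtain ⟨p, hp, rfl⟩ := hx
  exact ⟨p ^ n, by simpa using IsHomogeneous.pow hp n, map_pow π _ _⟩

theorem gradedPart_le_of_monomial_mem {n : ℕ} {N : Submodule ℝ A}
    (h : ∀ m : σ →₀ ℕ, m.degree = n → π (monomial m 1) ∈ N) : gradedPart π n ≤ N :=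
  Submodule.map_le_iff_le_comap.mpr (homogeneousSubmodule_le_of_monomial_mem h)

end GradedPart

end MvPolynomial

namespace PreAbstractSimplicialComplex

open MvPolynomial (gradedPart map_mem_gradedPart mul_mem_gradedPart pow_mem_gradedPart
  gradedPart_le_of_monomial_mem)

variable {V W : Type*}

/-! ### Quotients of face rings by linear forms -/

section FaceRing

variable (K : PreAbstractSimplicialComplex V) {ι : Type*} (Θ : ι → MvPolynomial V ℝ)
  {A : Type*} [CommRing A] [Algebra ℝ A] (π : MvPolynomial V ℝ →ₐ[ℝ] A)

/-- `π` presents `A` as the quotient of the face ring of `K` by the linear forms `Θ`. -/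
structure IsFaceQuotient : Prop where
  isHomogeneous : ∀ i, (Θ i).IsHomogeneous 1
  surjective : Function.Surjective π
  ker_eq : RingHom.ker π = K.faceIdeal ⊔ Ideal.span (Set.range Θ)

variable {K Θ π}

namespace IsFaceQuotient

theorem map_monomial (h : K.IsFaceQuotient Θ π) {m : V →₀ ℕ} (hm : ¬ K.IsFace m.support) :
    π (MvPolynomial.monomial m 1) = 0 := by
  rw [← RingHom.mem_ker, h.ker_eq]
  exact Ideal.mem_sup_left (Ideal.subset_span ⟨m, hm, rfl⟩)

theorem map_theta (h : K.IsFaceQuotient Θ π) (i : ι) : π (Θ i) = 0 := by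
  rw [← RingHom.mem_ker, h.ker_eq]
  exact Ideal.mem_sup_right (Ideal.subset_span ⟨i, rfl⟩)

theorem exists_lift (h : K.IsFaceQuotient Θ π) {B : Type*} [CommRing B] [Algebra ℝ B]
    (f : MvPolynomial V ℝ →ₐ[ℝ] B)
    (hf : ∀ m : V →₀ ℕ, ¬ K.IsFace m.support → f (MvPolynomial.monomial m 1) = 0)
    (hΘ : ∀ i, f (Θ i) = 0) : ∃ g : A →ₐ[ℝ] B, ∀ p, g (π p) = f p := by
  have hker : RingHom.ker π ≤ RingHom.ker f := by
    rw [h.ker_eq, sup_le_iff, faceIdeal, Ideal.span_le, Ideal.span_le]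
    constructor
    · rintro _ ⟨m, hm, rfl⟩
      exact hf m hm
    · rintro _ ⟨i, rfl⟩
      exact hΘ i
  refine ⟨(Ideal.Quotient.liftₐ (RingHom.ker π) f fun a ha => hker ha).comp
    (Ideal.quotientKerAlgEquivOfSurjective h.surjective).symm.toAlgHom, fun p => ?_⟩
  have : (Ideal.quotientKerAlgEquivOfSurjective h.surjective).symm (π p) =
      Ideal.Quotient.mk (RingHom.ker π) p := by
    rw [AlgEquiv.symm_apply_eq]
    rfl
  change Ideal.Quotient.liftₐ (RingHom.ker π) f (fun a ha => hker ha)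
    ((Ideal.quotientKerAlgEquivOfSurjective h.surjective).symm (π p)) = _
  rw [this]
  rfl

/-- The coaction `A → A[X]` that encodes the grading. -/
theorem exists_coaction (h : K.IsFaceQuotient Θ π) :
    ∃ γ : A →ₐ[ℝ] Polynomial A,
      ∀ n, ∀ x ∈ gradedPart π n, γ x = Polynomial.C x * Polynomial.X ^ n := by
  have key : ∀ n (p : MvPolynomial V ℝ), p.IsHomogeneous n →
      MvPolynomial.aeval (fun v => Polynomial.C (π (MvPolynomial.X v)) * Polynomial.X) p =
        Polynomial.C (π p) * Polynomial.X ^ n := fun n p hp => by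
    rw [MvPolynomial.aeval_C_mul_X_of_isHomogeneous _ hp]
    congr 2
    conv_rhs => rw [MvPolynomial.aeval_unique π]
    rfl
  obtain ⟨γ, hγ⟩ := h.exists_lift (MvPolynomial.aeval
    fun v => Polynomial.C (π (MvPolynomial.X v)) * Polynomial.X) (fun m hm => by
      rw [key _ _ (MvPolynomial.isHomogeneous_monomial 1 rfl), h.map_monomial hm, map_zero,
        zero_mul]) (fun i => by
      rw [key 1 _ (h.isHomogeneous i), h.map_theta i, map_zero, zero_mul])
  refine ⟨γ, ?_⟩
  rintro n _ ⟨p, hp, rfl⟩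
  exact (hγ p).trans (key n p hp)

/-! ### Vanishing above the rank -/

/-- The restrictions to a face of the linear forms in a l.s.o.p. span all linear forms. -/
theorem exists_theta_eq_single [DecidableEq V] (h : K.IsFaceQuotient Θ π) [Module.Finite ℝ A]
    {F : Finset V} (hF : K.IsFace F) (v : F) :
    ∃ θ ∈ Submodule.span ℝ (Set.range Θ), ∀ w : F,
      MvPolynomial.coeff (Finsupp.single (w : V) 1) θ = Pi.single (M := fun _ => ℝ) v 1 w := by
  classical
  let r : MvPolynomial V ℝ →ₗ[ℝ] (F → ℝ) :=
    LinearMap.pi fun w => MvPolynomial.lcoeff ℝ (Finsupp.single (w : V) 1)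
  suffices hs : Pi.single v 1 ∈ (Submodule.span ℝ (Set.range Θ)).map r by
    obtain ⟨θ, hθ, hr⟩ := hs
    exact ⟨θ, hθ, fun w => congrFun hr w⟩
  -- Otherwise a functional `φ` vanishes on all restrictions but not on the `v`-th unit vector. It
  -- is a nonzero common zero `g` of `Θ` supported on `F`, and restriction to the line through `g`
  -- maps the finite-dimensional `A` onto `ℝ[X]`.
  by_contra hv
  obtain ⟨φ, hφv, hφ⟩ := Submodule.exists_le_ker_of_notMem hv
  let g : V → ℝ := fun w => if h : w ∈ F then φ (Pi.single ⟨w, h⟩ 1) else 0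
  have hg : ∀ p : MvPolynomial V ℝ, p.IsHomogeneous 1 → MvPolynomial.aeval g p = φ (r p) := by
    intro p hp
    have := MvPolynomial.homogeneousSubmodule_one_le_of_X_mem
      (N := LinearMap.eqLocus (MvPolynomial.aeval g).toLinearMap (φ ∘ₗ r)) (fun w => by
      simp only [LinearMap.mem_eqLocus, AlgHom.toLinearMap_apply, MvPolynomial.aeval_X,
        LinearMap.comp_apply]
      by_cases hw : w ∈ F
      · have : r (MvPolynomial.X w) = Pi.single ⟨w, hw⟩ 1 := by
          ext u
          simp [r, MvPolynomial.lcoeff, MvPolynomial.coeff_X, Pi.single_apply,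
            Subtype.ext_iff, eq_comm, Finsupp.single_left_inj]
        simp [g, hw, this]
      · have : r (MvPolynomial.X w) = 0 := by
          ext u
          have : w ≠ u := fun h => hw (h ▸ u.2)
          simp [r, MvPolynomial.lcoeff, MvPolynomial.coeff_X, Finsupp.single_left_inj, this]
        simp [g, hw, this])
    exact this hp
  obtain ⟨γ, hγ⟩ := h.exists_lift
    (MvPolynomial.aeval fun w => Polynomial.C (g w) * Polynomial.X) (by
      intro m hm
      obtain ⟨w, hw, hwF⟩ := Finset.not_subset.mp fun h => hm (hF.mono h)
      rw [MvPolynomial.aeval_C_mul_X_of_isHomogeneous g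
        (MvPolynomial.isHomogeneous_monomial 1 rfl), MvPolynomial.aeval_monomial, Finsupp.prod,
        Finset.prod_eq_zero hw, mul_zero, map_zero, zero_mul]
      rw [show g w = 0 by simp [g, hwF], zero_pow (Finsupp.mem_support_iff.mp hw)]) (by
      intro i
      rw [MvPolynomial.aeval_C_mul_X_of_isHomogeneous g (h.isHomogeneous i),
        hg _ (h.isHomogeneous i), LinearMap.mem_ker.mp (hφ ⟨_, Submodule.subset_span ⟨i, rfl⟩, rfl⟩),
        map_zero, zero_mul])
  have hsurj : Function.Surjective γ := by
    rw [← AlgHom.range_eq_top, eq_top_iff, ← Polynomial.adjoin_X, Algebra.adjoin_le_iff,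
      Set.singleton_subset_iff]
    refine ⟨π (MvPolynomial.C (φ (Pi.single v 1))⁻¹ * MvPolynomial.X (v : V)), ?_⟩
    have hgv : g v = φ (Pi.single v 1) := by simp [g]
    refine (hγ _).trans ?_
    rw [map_mul, MvPolynomial.aeval_X, hgv, MvPolynomial.aeval_C, Polynomial.algebraMap_apply,
      Algebra.algebraMap_self, RingHom.id_apply, ← mul_assoc, ← map_mul, inv_mul_cancel₀ hφv,
      map_one, one_mul]
  exact Polynomial.not_finite (Module.Finite.of_surjective γ.toLinearMap hsurj)

variable [Finite V]

/-- A repeated variable can be traded, modulo `Θ`, for variables outside the support, which enlarges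
the support. Once it has more than `K.rank` elements it is not a face. -/
theorem map_monomial_eq_zero_of_rank_lt (h : K.IsFaceQuotient Θ π)
    [Module.Finite ℝ A] (m : V →₀ ℕ) (hm : K.rank < m.degree) :
    π (MvPolynomial.monomial m 1) = 0 := by
  classical
  have := Fintype.ofFinite V
  obtain ⟨r, hr⟩ : ∃ r, K.rank < m.support.card + r := ⟨K.rank + 1, by omega⟩
  induction r generalizing m with
  | zero =>
    exact h.map_monomial fun hf => absurd hf.card_le_rank (by omega)
  | succ r ih =>
    by_cases hF : K.IsFace m.support
    swap
    · exact h.map_monomial hF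
    obtain ⟨v, hv, hv2⟩ : ∃ v ∈ m.support, 1 < m v := by
      by_contra! hle
      have : m.degree ≤ m.support.card := by
        rw [Finsupp.degree_apply]
        simpa using Finset.sum_le_card_nsmul _ _ 1 hle
      have := hF.card_le_rank
      omega
    obtain ⟨m', rfl⟩ := exists_add_of_le (Finsupp.single_le_iff.mpr hv2.le)
    obtain ⟨θ, hθ, hθc⟩ := h.exists_theta_eq_single hF ⟨v, hv⟩
    have hθ0 : π θ = 0 := by
      have : Submodule.span ℝ (Set.range Θ) ≤ LinearMap.ker (π).toLinearMap :=
        Submodule.span_le.mpr (by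
          rintro _ ⟨i, rfl⟩
          exact h.map_theta i)
      exact this hθ
    have hθ1 : θ.IsHomogeneous 1 := by
      have : Submodule.span ℝ (Set.range Θ) ≤ MvPolynomial.homogeneousSubmodule V ℝ 1 :=
        Submodule.span_le.mpr (by
          rintro _ ⟨i, rfl⟩
          exact h.isHomogeneous i)
      exact this hθ
    have hsum : θ = ∑ w, MvPolynomial.coeff (Finsupp.single w 1) θ • MvPolynomial.X w := by
      have := MvPolynomial.homogeneousSubmodule_one_le_of_X_mem
        (N := LinearMap.eqLocus LinearMap.id (∑ w : V,
          (MvPolynomial.lcoeff ℝ (Finsupp.single w 1)).smulRight (MvPolynomial.X w))) (fun u => by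
        simp [MvPolynomial.lcoeff, MvPolynomial.coeff_X, Finsupp.single_left_inj]) hθ1
      simpa [MvPolynomial.lcoeff] using this
    -- As `v` has exponent at least two, removing one copy keeps the support.
    have hsupp : (Finsupp.single v 1 + m').support = m'.support := by
      ext u
      simp only [Finsupp.mem_support_iff, Finsupp.add_apply, ne_eq]
      by_cases hu : v = u
      · subst hu
        simp only [Finsupp.add_apply, Finsupp.single_eq_same] at hv2 ⊢
        omega
      · rw [Finsupp.single_eq_of_ne (Ne.symm hu), zero_add]
    have hmul : π (MvPolynomial.monomial m' 1 * θ) = 0 := by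
      rw [map_mul, hθ0, mul_zero]
    have hX : ∀ w, MvPolynomial.monomial m' (1 : ℝ) * MvPolynomial.X w =
        MvPolynomial.monomial (Finsupp.single w 1 + m') 1 := fun w => by
      rw [MvPolynomial.X, MvPolynomial.monomial_mul, one_mul, add_comm]
    rw [hsum, Finset.mul_sum, map_sum, Finset.sum_eq_single v] at hmul
    · have h1 : MvPolynomial.coeff (Finsupp.single v 1) θ = 1 := by
        rw [hθc ⟨v, hv⟩, Pi.single_eq_same]
      rwa [h1, one_smul, hX] at hmul
    · intro w _ hwv
      rw [mul_smul_comm, hX, map_smul]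
      by_cases hw : w ∈ (Finsupp.single v 1 + m').support
      · rw [hθc ⟨w, hw⟩, Pi.single_eq_of_ne (fun he => hwv (congrArg Subtype.val he)), zero_smul]
      · have hsw : (Finsupp.single w 1 + m').support = insert w m'.support := by
          ext u
          by_cases hu : w = u
          · subst hu; simp
          · simp [Finsupp.single_eq_of_ne (Ne.symm hu), Ne.symm hu]
        rw [hsupp] at hw hr
        rw [ih, smul_zero]
        · simpa using hm
        · rw [hsw, Finset.card_insert_of_notMem hw]
          omega
    · intro hv'
      exact absurd (Finset.mem_univ v) hv'

theorem gradedPart_eq_bot_of_rank_lt (h : K.IsFaceQuotient Θ π)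
    [Module.Finite ℝ A] {n : ℕ} (hn : K.rank < n) : gradedPart π n = ⊥ :=
  eq_bot_iff.mpr (gradedPart_le_of_monomial_mem fun m hm =>
    (Submodule.mem_bot ℝ).mpr (h.map_monomial_eq_zero_of_rank_lt m (hm ▸ hn)))

end IsFaceQuotient

/-! ### Hard-Lefschetz elements -/

variable (K π) in
/-- The hard-Lefschetz property for a linear form, with respect to a presentation `π`. -/
noncomputable def IsLefschetz (ω : MvPolynomial V ℝ) : Prop :=
  ω.IsHomogeneous 1 ∧ ∀ i, 2 * i ≤ K.rank →
    Set.BijOn (fun m : A => π ω ^ (K.rank - 2 * i) * m)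
      (gradedPart π i) (gradedPart π (K.rank - i))

theorem IsLefschetz.finrank_eq {ω : MvPolynomial V ℝ} (hω : K.IsLefschetz π ω) {i : ℕ}
    (hi : i ≤ K.rank) :
    Module.finrank ℝ (gradedPart π i) = Module.finrank ℝ (gradedPart π (K.rank - i)) := by
  have key : ∀ i, 2 * i ≤ K.rank →
      Module.finrank ℝ (gradedPart π i) = Module.finrank ℝ (gradedPart π (K.rank - i)) := by
    intro i hi
    have h := hω.2 i hi
    exact (LinearEquiv.ofBijective ((LinearMap.mulLeft ℝ
      (π ω ^ (K.rank - 2 * i))).restrict h.mapsTo) ⟨fun x y hxy => Subtype.ext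
        (h.injOn x.2 y.2 (congrArg Subtype.val hxy)), fun y => by
        obtain ⟨x, hx, hxy⟩ := h.surjOn y.2
        exact ⟨⟨x, hx⟩, Subtype.ext hxy⟩⟩).finrank_eq
  rcases le_total (2 * i) K.rank with h | h
  · exact key i h
  · rw [key (K.rank - i) (by omega), Nat.sub_sub_self hi]

/-! ### The Hilbert polynomial -/

variable (K π) in
/-- The Hilbert polynomial `∑ i, dim H(K, Θ)_i * X ^ i` in degrees up to the rank. -/
noncomputable def hilbertPoly : Polynomial ℕ :=
  ∑ i ∈ Finset.range (K.rank + 1),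
    Polynomial.C (Module.finrank ℝ (gradedPart π i)) * Polynomial.X ^ i

theorem natDegree_hilbertPoly_le : (K.hilbertPoly π).natDegree ≤ K.rank :=
  Polynomial.natDegree_sum_le_of_forall_le _ _ fun _ hi =>
    (Polynomial.natDegree_C_mul_X_pow_le _ _).trans (Nat.lt_succ_iff.mp (Finset.mem_range.mp hi))

variable [Finite V]

theorem IsFaceQuotient.coeff_hilbertPoly (h : K.IsFaceQuotient Θ π) [Module.Finite ℝ A] (n : ℕ) :
    (K.hilbertPoly π).coeff n = Module.finrank ℝ (gradedPart π n) := by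
  rw [hilbertPoly, Polynomial.finsetSum_coeff]
  simp only [Polynomial.coeff_C_mul_X_pow]
  rw [Finset.sum_ite_eq]
  split_ifs with hn
  · rfl
  · rw [h.gradedPart_eq_bot_of_rank_lt (by simpa using hn), finrank_bot]

/-- The coaction separates degrees, so the graded parts are independent; they span because monomials
above the rank vanish. -/
theorem IsFaceQuotient.eval_one_hilbertPoly (h : K.IsFaceQuotient Θ π) [Module.Finite ℝ A] :
    (K.hilbertPoly π).eval 1 = Module.finrank ℝ (A) := by
  classical
  let S : ((i : Fin (K.rank + 1)) → gradedPart π i) →ₗ[ℝ] A :=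
    LinearMap.lsum ℝ (fun i : Fin (K.rank + 1) => gradedPart π i) ℝ
      fun i => (gradedPart π i).subtype
  have hS : ∀ x, S x = ∑ i, (x i : A) := fun x => by simp [S]
  obtain ⟨γ, hγ⟩ := h.exists_coaction
  have hinj : Function.Injective S := by
    rw [injective_iff_map_eq_zero]
    intro x hx
    have hγx := congrArg γ hx
    rw [hS, map_sum, map_zero, Finset.sum_congr rfl fun i _ => hγ (i : Fin _) _ (x i).2] at hγx
    ext i
    have := congrArg (fun q => Polynomial.coeff q (i : ℕ)) hγx
    simp only [Polynomial.finsetSum_coeff, Polynomial.coeff_C_mul_X_pow,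
      Polynomial.coeff_zero] at this
    rw [Finset.sum_eq_single i] at this
    · simpa using this
    · intro j _ hji
      exact if_neg fun he => hji (Fin.ext he.symm)
    · intro hi
      exact absurd (Finset.mem_univ i) hi
  have hsurj : Function.Surjective S := by
    rw [← LinearMap.range_eq_top, eq_top_iff]
    intro x _
    obtain ⟨p, rfl⟩ := h.surjective x
    rw [p.as_sum, map_sum]
    refine sum_mem fun m _ => ?_
    rw [← mul_one (MvPolynomial.coeff m p), ← smul_eq_mul, ← MvPolynomial.smul_monomial, map_smul]
    refine Submodule.smul_mem _ _ ?_
    by_cases hm : m.degree < K.rank + 1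
    · refine ⟨Pi.single ⟨m.degree, hm⟩ ⟨_, map_mem_gradedPart π
        (MvPolynomial.isHomogeneous_monomial 1 rfl)⟩, ?_⟩
      rw [hS, Finset.sum_eq_single ⟨m.degree, hm⟩, Pi.single_eq_same]
      · intro i _ hi
        rw [Pi.single_eq_of_ne hi, ZeroMemClass.coe_zero]
      · intro hi
        exact absurd (Finset.mem_univ _) hi
    · rw [h.map_monomial_eq_zero_of_rank_lt m (by omega)]
      exact zero_mem _
  rw [← (LinearEquiv.ofBijective S ⟨hinj, hsurj⟩).finrank_eq, Module.finrank_pi_fintype,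
    hilbertPoly, Polynomial.eval_finsetSum, Finset.sum_range]
  simp

theorem IsLefschetz.reflect_hilbertPoly (h : K.IsFaceQuotient Θ π)
    [Module.Finite ℝ A] {ω : MvPolynomial V ℝ} (hω : K.IsLefschetz π ω) :
    Polynomial.reflect K.rank (K.hilbertPoly π) = K.hilbertPoly π := by
  ext n
  rw [Polynomial.coeff_reflect]
  rcases le_or_gt n K.rank with hn | hn
  · rw [Polynomial.revAt_le hn, h.coeff_hilbertPoly, h.coeff_hilbertPoly, ← hω.finrank_eq hn]
  · rw [Polynomial.revAt_eq_self_of_lt hn]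

/-- `H(K, Θ)` is spanned by the strings starting at primitive elements. -/
theorem IsLefschetz.gradedPart_le_span_strings (h : K.IsFaceQuotient Θ π)
    [Module.Finite ℝ A] {ω : MvPolynomial V ℝ} (hω : K.IsLefschetz π ω) {i : ℕ}
    (hi : i ≤ K.rank) :
    gradedPart π i ≤ Submodule.span ℝ {x | ∃ a j p, a + j = i ∧ i + a ≤ K.rank ∧
      p ∈ gradedPart π a ∧ π ω ^ (K.rank - 2 * a + 1) * p = 0 ∧
      x = π ω ^ j * p} := by
  have hω1 := map_mem_gradedPart π hω.1
  have key : ∀ i, 2 * i ≤ K.rank → gradedPart π i ≤ Submodule.span ℝ {x | ∃ a j p, a + j = i ∧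
      i + a ≤ K.rank ∧ p ∈ gradedPart π a ∧ π ω ^ (K.rank - 2 * a + 1) * p = 0 ∧
      x = π ω ^ j * p} := by
    intro i
    induction i with
    | zero =>
      intro _ x hx
      refine Submodule.subset_span ⟨0, 0, x, rfl, Nat.zero_le _, hx, ?_, by simp⟩
      have := mul_mem_gradedPart (pow_mem_gradedPart hω1 (K.rank + 1)) hx
      rw [h.gradedPart_eq_bot_of_rank_lt (by omega)] at this
      simpa using this
    | succ i ih =>
      intro hi x hx
      have h1 : π ω ^ (K.rank - 2 * (i + 1) + 1) * x ∈ gradedPart π (K.rank - i) := by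
        have := mul_mem_gradedPart
          (pow_mem_gradedPart hω1 (K.rank - 2 * (i + 1) + 1)) hx
        rwa [show K.rank - 2 * (i + 1) + 1 + (i + 1) = K.rank - i by omega] at this
      -- With `d = K.rank`, this `y` satisfies `ω ^ (d - 2i) * y = ω ^ (d - 2i - 1) * x`, so `x - ω
      -- * y` is primitive.
      obtain ⟨y, hy, hyx⟩ := (hω.2 i (by omega)).surjOn h1
      have hωy : π ω * y ∈ gradedPart π (i + 1) := by
        have := mul_mem_gradedPart hω1 hy
        rwa [add_comm] at this
      have hx' : x = (x - π ω * y) + π ω * y := by ring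
      rw [hx']
      refine add_mem (Submodule.subset_span ⟨i + 1, 0, _, rfl, by omega, sub_mem hx hωy, ?_,
        by simp⟩) ?_
      · rw [mul_sub, ← hyx, ← mul_assoc, ← pow_succ,
          show K.rank - 2 * (i + 1) + 1 + 1 = K.rank - 2 * i by omega, sub_self]
      · refine (Submodule.map_span_le (LinearMap.mulLeft ℝ (π ω)) _ _).mpr ?_
          (Submodule.mem_map_of_mem (ih (by omega) hy))
        rintro _ ⟨a, j, p, haj, hia, hp, hp0, rfl⟩
        refine Submodule.subset_span ⟨a, j + 1, p, by omega, by omega, hp, hp0, ?_⟩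
        rw [LinearMap.mulLeft_apply, pow_succ']
        ring
  rcases le_total (2 * i) K.rank with h' | h'
  · exact key i h'
  · intro x hx
    -- Above the middle, the Lefschetz isomorphism from degree `K.rank - i` prolongs the strings
    -- already found.
    have h1 := (hω.2 (K.rank - i) (by omega)).surjOn
    rw [Nat.sub_sub_self hi] at h1
    obtain ⟨y, hy, rfl⟩ := h1 hx
    refine (Submodule.map_span_le (LinearMap.mulLeft ℝ
      (π ω ^ (K.rank - 2 * (K.rank - i)))) _ _).mpr ?_
      (Submodule.mem_map_of_mem (key (K.rank - i) (by omega) hy))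
    rintro _ ⟨a, j, p, haj, hia, hp, hp0, rfl⟩
    refine Submodule.subset_span ⟨a, K.rank - 2 * (K.rank - i) + j, p, by omega, by omega, hp,
      hp0, ?_⟩
    rw [LinearMap.mulLeft_apply, pow_add]
    ring

end FaceRing

end PreAbstractSimplicialComplex

/-! ### Joins of complexes and their quotient rings -/

namespace PreAbstractSimplicialComplex

open MvPolynomial (gradedPart map_mem_gradedPart mul_mem_gradedPart pow_mem_gradedPart
  gradedPart_le_of_monomial_mem)

open scoped TensorProduct

variable {V W : Type*}

theorem isFaceQuotient_proj (K : PreAbstractSimplicialComplex V) {ι : Type*}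
    {Θ : ι → MvPolynomial V ℝ} (hΘ : ∀ i, (Θ i).IsHomogeneous 1) :
    K.IsFaceQuotient (A := K.H Θ) Θ (K.proj Θ) where
  isHomogeneous := hΘ
  surjective := (Ideal.Quotient.mkₐ_surjective ℝ _).comp (Ideal.Quotient.mkₐ_surjective ℝ _)
  ker_eq := by
    have h1 : K.thetaIdeal Θ =
        (Ideal.span (Set.range Θ)).map (Ideal.Quotient.mk K.faceIdeal) := by
      rw [thetaIdeal, Ideal.map_span, ← Set.range_comp]
      rfl
    have h2 : RingHom.ker (K.proj Θ) =
        (K.thetaIdeal Θ).comap (Ideal.Quotient.mk K.faceIdeal) := by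
      ext p
      exact Ideal.Quotient.eq_zero_iff_mem
    rw [h2, h1, Ideal.comap_map_of_surjective' _ Ideal.Quotient.mk_surjective, Ideal.mk_ker,
      sup_comm]

theorem isHomogeneous_joinTheta {ι κ : Type*} {ΘK : ι → MvPolynomial V ℝ}
    {ΘL : κ → MvPolynomial W ℝ} (hK : ∀ i, (ΘK i).IsHomogeneous 1)
    (hL : ∀ i, (ΘL i).IsHomogeneous 1) (i : ι ⊕ κ) : (joinTheta ΘK ΘL i).IsHomogeneous 1 := by
  rcases i with i | i
  · exact (hK i).rename_isHomogeneous
  · exact (hL i).rename_isHomogeneous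

theorem monomial_eq_rename_mul_rename (m : V ⊕ W →₀ ℕ) :
    ∃ (m₁ : V →₀ ℕ) (m₂ : W →₀ ℕ), m₁.support = m.support.toLeft ∧
      m₂.support = m.support.toRight ∧ m₁.degree + m₂.degree = m.degree ∧
      MvPolynomial.monomial m (1 : ℝ) =
        MvPolynomial.rename Sum.inl (MvPolynomial.monomial m₁ 1) *
          MvPolynomial.rename Sum.inr (MvPolynomial.monomial m₂ 1) := by
  have hm : m = (m.comapDomain Sum.inl Sum.inl_injective.injOn).mapDomain Sum.inl +
      (m.comapDomain Sum.inr Sum.inr_injective.injOn).mapDomain Sum.inr := by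
    ext (v | w)
    · rw [Finsupp.add_apply, Finsupp.mapDomain_apply Sum.inl_injective,
        Finsupp.mapDomain_of_notMem_range _ _ (by simp), add_zero]
      rfl
    · rw [Finsupp.add_apply, Finsupp.mapDomain_apply Sum.inr_injective,
        Finsupp.mapDomain_of_notMem_range _ _ (by simp), zero_add]
      rfl
  refine ⟨m.comapDomain Sum.inl Sum.inl_injective.injOn,
    m.comapDomain Sum.inr Sum.inr_injective.injOn, ?_, ?_, ?_, ?_⟩
  · ext v; simp
  · ext v; simp
  · conv_rhs => rw [hm, map_add, Finsupp.degree_mapDomain, Finsupp.degree_mapDomain]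
  · rw [MvPolynomial.rename_monomial, MvPolynomial.rename_monomial, MvPolynomial.monomial_mul,
      one_mul, ← hm]

section Join

variable {K : PreAbstractSimplicialComplex V} {L : PreAbstractSimplicialComplex W}
  {ι κ : Type*} {ΘK : ι → MvPolynomial V ℝ} {ΘL : κ → MvPolynomial W ℝ}
  {A B C : Type*} [CommRing A] [Algebra ℝ A] [CommRing B] [Algebra ℝ B] [CommRing C] [Algebra ℝ C]
  {πA : MvPolynomial V ℝ →ₐ[ℝ] A} {πB : MvPolynomial W ℝ →ₐ[ℝ] B}
  {πC : MvPolynomial (V ⊕ W) ℝ →ₐ[ℝ] C}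

/-! ### The quotient of the face ring of a join as a tensor product -/

theorem IsFaceQuotient.exists_left (hA : K.IsFaceQuotient ΘK πA)
    (hC : (K.join L).IsFaceQuotient (joinTheta ΘK ΘL) πC) :
    ∃ α : A →ₐ[ℝ] C, ∀ p, α (πA p) = πC (MvPolynomial.rename Sum.inl p) := by
  classical
  refine hA.exists_lift (πC.comp (MvPolynomial.rename Sum.inl)) (fun m hm => ?_)
    fun i => hC.map_theta (Sum.inl i)
  rw [AlgHom.comp_apply, MvPolynomial.rename_monomial]
  refine hC.map_monomial fun h => hm ?_
  rw [isFace_join_iff] at h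
  refine h.1.mono fun v hv => ?_
  rw [Finset.mem_toLeft, Finsupp.mapDomain_support_of_injective Sum.inl_injective]
  exact Finset.mem_image_of_mem _ hv

theorem IsFaceQuotient.exists_right (hB : L.IsFaceQuotient ΘL πB)
    (hC : (K.join L).IsFaceQuotient (joinTheta ΘK ΘL) πC) :
    ∃ β : B →ₐ[ℝ] C, ∀ p, β (πB p) = πC (MvPolynomial.rename Sum.inr p) := by
  classical
  refine hB.exists_lift (πC.comp (MvPolynomial.rename Sum.inr)) (fun m hm => ?_)
    fun i => hC.map_theta (Sum.inr i)
  rw [AlgHom.comp_apply, MvPolynomial.rename_monomial]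
  refine hC.map_monomial fun h => hm ?_
  rw [isFace_join_iff] at h
  refine h.2.mono fun v hv => ?_
  rw [Finset.mem_toRight, Finsupp.mapDomain_support_of_injective Sum.inr_injective]
  exact Finset.mem_image_of_mem _ hv

/-- Each variable of the join comes from `A` or `B`, so `A ⊗ B → C` is onto. -/
theorem IsFaceQuotient.finite_join (hA : K.IsFaceQuotient ΘK πA) (hB : L.IsFaceQuotient ΘL πB)
    (hC : (K.join L).IsFaceQuotient (joinTheta ΘK ΘL) πC) [Module.Finite ℝ A]
    [Module.Finite ℝ B] : Module.Finite ℝ C := by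
  obtain ⟨α, hα⟩ := hA.exists_left hC
  obtain ⟨β, hβ⟩ := hB.exists_right hC
  refine Module.Finite.of_surjective (Algebra.TensorProduct.productMap α β).toLinearMap ?_
  change Function.Surjective (Algebra.TensorProduct.productMap α β)
  rw [← AlgHom.range_eq_top, eq_top_iff]
  rintro x -
  obtain ⟨p, rfl⟩ := hC.surjective x
  induction p using MvPolynomial.induction_on with
  | C a =>
    rw [← MvPolynomial.algebraMap_eq, AlgHom.commutes]
    exact Subalgebra.algebraMap_mem _ _
  | add p q hp hq => rw [map_add]; exact add_mem hp hq
  | mul_X p v hp =>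
    rw [map_mul]
    refine mul_mem hp ?_
    rcases v with v | w
    · refine ⟨πA (MvPolynomial.X v) ⊗ₜ 1, ?_⟩
      simp [hα]
    · refine ⟨1 ⊗ₜ πB (MvPolynomial.X w), ?_⟩
      simp [hβ]

theorem IsFaceQuotient.finrank_mul_le_join (hA : K.IsFaceQuotient ΘK πA)
    (hB : L.IsFaceQuotient ΘL πB) (hC : (K.join L).IsFaceQuotient (joinTheta ΘK ΘL) πC)
    [Module.Finite ℝ A] [Module.Finite ℝ B] [Module.Finite ℝ C] :
    Module.finrank ℝ A * Module.finrank ℝ B ≤ Module.finrank ℝ C := by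
  let f : MvPolynomial (V ⊕ W) ℝ →ₐ[ℝ] A ⊗[ℝ] B := MvPolynomial.aeval
    (Sum.elim (fun v => πA (MvPolynomial.X v) ⊗ₜ 1) fun w => 1 ⊗ₜ πB (MvPolynomial.X w))
  have hfl : ∀ p, f (MvPolynomial.rename Sum.inl p) = πA p ⊗ₜ 1 := fun p => by
    have : f.comp (MvPolynomial.rename Sum.inl) =
        (Algebra.TensorProduct.includeLeft : A →ₐ[ℝ] A ⊗[ℝ] B).comp πA := by
      ext v
      simp [f]
    exact DFunLike.congr_fun this p
  have hfr : ∀ p, f (MvPolynomial.rename Sum.inr p) = 1 ⊗ₜ πB p := fun p => by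
    have : f.comp (MvPolynomial.rename Sum.inr) =
        (Algebra.TensorProduct.includeRight : B →ₐ[ℝ] A ⊗[ℝ] B).comp πB := by
      ext v
      simp [f]
    exact DFunLike.congr_fun this p
  obtain ⟨ψ, hψ⟩ := hC.exists_lift f (fun m hm => by
    obtain ⟨m₁, m₂, h1, h2, -, h⟩ := monomial_eq_rename_mul_rename m
    rw [isFace_join_iff, not_and_or, ← h1, ← h2] at hm
    rw [h, map_mul, hfl, hfr, Algebra.TensorProduct.tmul_mul_tmul, one_mul, mul_one]
    rcases hm with hm | hm
    · rw [hA.map_monomial hm, TensorProduct.zero_tmul]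
    · rw [hB.map_monomial hm, TensorProduct.tmul_zero]) (by
    rintro (i | i)
    · exact (hfl _).trans (by rw [hA.map_theta, TensorProduct.zero_tmul])
    · exact (hfr _).trans (by rw [hB.map_theta, TensorProduct.tmul_zero]))
  have hsurj : LinearMap.range ψ.toLinearMap = ⊤ := by
    rw [eq_top_iff]
    rintro x -
    induction x using TensorProduct.induction_on with
    | zero => exact zero_mem _
    | tmul a b =>
      obtain ⟨p, rfl⟩ := hA.surjective a
      obtain ⟨q, rfl⟩ := hB.surjective b
      refine ⟨πC (MvPolynomial.rename Sum.inl p * MvPolynomial.rename Sum.inr q), ?_⟩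
      refine (hψ _).trans ?_
      rw [map_mul, hfl, hfr, Algebra.TensorProduct.tmul_mul_tmul, one_mul, mul_one]
    | add x y hx hy => exact add_mem hx hy
  rw [← Module.finrank_tensorProduct, ← finrank_top ℝ (A ⊗[ℝ] B), ← hsurj]
  exact LinearMap.finrank_range_le _

theorem gradedPart_join_le {α : A →ₐ[ℝ] C} {β : B →ₐ[ℝ] C}
    (hα : ∀ p, α (πA p) = πC (MvPolynomial.rename Sum.inl p))
    (hβ : ∀ p, β (πB p) = πC (MvPolynomial.rename Sum.inr p)) (n : ℕ) :
    gradedPart πC n ≤ (Finset.HasAntidiagonal.antidiagonal n).sup fun p =>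
      (gradedPart πA p.1).map α.toLinearMap * (gradedPart πB p.2).map β.toLinearMap := by
  refine gradedPart_le_of_monomial_mem fun m hm => ?_
  obtain ⟨m₁, m₂, -, -, hd, h⟩ := monomial_eq_rename_mul_rename m
  have hle := Finset.le_sup (f := fun p : ℕ × ℕ =>
      (gradedPart πA p.1).map α.toLinearMap * (gradedPart πB p.2).map β.toLinearMap)
    (b := (m₁.degree, m₂.degree)) (Finset.HasAntidiagonal.mem_antidiagonal.mpr (hd.trans hm))
  refine hle ?_
  rw [h, map_mul, ← hα, ← hβ]
  exact Submodule.mul_mem_mul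
    ⟨_, map_mem_gradedPart πA (MvPolynomial.isHomogeneous_monomial 1 rfl), rfl⟩
    ⟨_, map_mem_gradedPart πB (MvPolynomial.isHomogeneous_monomial 1 rfl), rfl⟩

theorem _root_.Submodule.finrank_finset_sup_le {ι M : Type*} [AddCommGroup M] [Module ℝ M]
    [Module.Finite ℝ M] (s : Finset ι) (N : ι → Submodule ℝ M) :
    Module.finrank ℝ (s.sup N : Submodule ℝ M) ≤ ∑ i ∈ s, Module.finrank ℝ (N i) := by
  classical
  induction s using Finset.induction_on with
  | empty => simp
  | insert i s hi ih =>
    rw [Finset.sup_insert, Finset.sum_insert hi]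
    exact (Submodule.finrank_add_le_finrank_add_finrank _ _).trans (Nat.add_le_add_left ih _)

theorem _root_.Submodule.finrank_mul_le {M : Type*} [CommRing M] [Algebra ℝ M]
    [Module.Finite ℝ M] (S T : Submodule ℝ M) :
    Module.finrank ℝ (S * T : Submodule ℝ M) ≤ Module.finrank ℝ S * Module.finrank ℝ T := by
  rw [← Submodule.mulMap_range, ← Module.finrank_tensorProduct]
  exact LinearMap.finrank_range_le _

/-! ### Hilbert polynomial and Lefschetz property of the join -/

variable [Finite V] [Finite W]

/-- Coefficientwise `≤` comes from products of graded parts spanning `C`; the reverse inequality of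
the values at `1` forces equality in every degree. -/
theorem IsFaceQuotient.hilbertPoly_join (hA : K.IsFaceQuotient ΘK πA)
    (hB : L.IsFaceQuotient ΘL πB) (hC : (K.join L).IsFaceQuotient (joinTheta ΘK ΘL) πC)
    [Module.Finite ℝ A] [Module.Finite ℝ B] [Module.Finite ℝ C] :
    (K.join L).hilbertPoly πC = K.hilbertPoly πA * L.hilbertPoly πB := by
  obtain ⟨α, hα⟩ := hA.exists_left hC
  obtain ⟨β, hβ⟩ := hB.exists_right hC
  have hle : ∀ n, ((K.join L).hilbertPoly πC).coeff n ≤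
      (K.hilbertPoly πA * L.hilbertPoly πB).coeff n := by
    intro n
    rw [hC.coeff_hilbertPoly, Polynomial.coeff_mul]
    refine (Submodule.finrank_mono (gradedPart_join_le hα hβ n)).trans
      ((Submodule.finrank_finset_sup_le _ _).trans (Finset.sum_le_sum fun p _ => ?_))
    rw [hA.coeff_hilbertPoly, hB.coeff_hilbertPoly]
    exact (Submodule.finrank_mul_le _ _).trans (Nat.mul_le_mul
      (Submodule.finrank_map_le _ _) (Submodule.finrank_map_le _ _))
  have hd1 := natDegree_hilbertPoly_le (K := K.join L) (π := πC)
  have hd2 : (K.hilbertPoly πA * L.hilbertPoly πB).natDegree ≤ (K.join L).rank := by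
    rw [rank_join]
    exact Polynomial.natDegree_mul_le.trans
      (add_le_add natDegree_hilbertPoly_le natDegree_hilbertPoly_le)
  have hev : (K.hilbertPoly πA * L.hilbertPoly πB).eval 1 ≤
      ((K.join L).hilbertPoly πC).eval 1 := by
    rw [Polynomial.eval_mul, hA.eval_one_hilbertPoly, hB.eval_one_hilbertPoly,
      hC.eval_one_hilbertPoly]
    exact hA.finrank_mul_le_join hB hC
  rw [Polynomial.eval_eq_sum_range' (Nat.lt_succ_of_le hd1),
    Polynomial.eval_eq_sum_range' (Nat.lt_succ_of_le hd2)] at hev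
  simp only [one_pow, mul_one] at hev
  have heq := (Finset.sum_eq_sum_iff_of_le fun n _ => hle n).mp
    (le_antisymm (Finset.sum_le_sum fun n _ => hle n) hev)
  ext n
  rcases Nat.lt_or_ge n ((K.join L).rank + 1) with h | h
  · exact heq n (Finset.mem_range.mpr h)
  · rw [Polynomial.coeff_eq_zero_of_natDegree_lt (by omega),
      Polynomial.coeff_eq_zero_of_natDegree_lt (by omega)]

theorem IsLefschetz.join (hA : K.IsFaceQuotient ΘK πA)
    (hB : L.IsFaceQuotient ΘL πB) (hC : (K.join L).IsFaceQuotient (joinTheta ΘK ΘL) πC)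
    [Module.Finite ℝ A] [Module.Finite ℝ B] {ωK : MvPolynomial V ℝ} {ωL : MvPolynomial W ℝ}
    (hωK : K.IsLefschetz πA ωK) (hωL : L.IsLefschetz πB ωL) :
    (K.join L).IsLefschetz πC
      (MvPolynomial.rename Sum.inl ωK + MvPolynomial.rename Sum.inr ωL) := by
  have := hA.finite_join hB hC
  have hω : (MvPolynomial.rename Sum.inl ωK + MvPolynomial.rename Sum.inr ωL :
      MvPolynomial (V ⊕ W) ℝ).IsHomogeneous 1 :=
    hωK.1.rename_isHomogeneous.add hωL.1.rename_isHomogeneous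
  refine ⟨hω, fun i hi => ?_⟩
  obtain ⟨α, hα⟩ := hA.exists_left hC
  obtain ⟨β, hβ⟩ := hB.exists_right hC
  have hαm : ∀ {n x}, x ∈ gradedPart πA n → α x ∈ gradedPart πC n := by
    rintro n _ ⟨p, hp, rfl⟩
    exact ⟨_, MvPolynomial.IsHomogeneous.rename_isHomogeneous hp, (hα p).symm⟩
  have hβm : ∀ {n x}, x ∈ gradedPart πB n → β x ∈ gradedPart πC n := by
    rintro n _ ⟨p, hp, rfl⟩
    exact ⟨_, MvPolynomial.IsHomogeneous.rename_isHomogeneous hp, (hβ p).symm⟩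
  have hω1 := map_mem_gradedPart πC hω
  set ω := πC (MvPolynomial.rename Sum.inl ωK + MvPolynomial.rename Sum.inr ωL) with hωdef
  have hωst : ω = α (πA ωK) + β (πB ωL) := by rw [hωdef, map_add, hα, hβ]
  set D := (K.join L).rank with hD
  have hDr : D = K.rank + L.rank := rank_join K L
  have hmaps : ∀ x ∈ gradedPart πC i, LinearMap.mulLeft ℝ (ω ^ (D - 2 * i)) x ∈
      gradedPart πC (D - i) := fun x hx => by
    have := mul_mem_gradedPart (pow_mem_gradedPart hω1 (D - 2 * i)) hx
    rwa [show D - 2 * i + i = D - i by omega] at this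
  have hsurj : gradedPart πC (D - i) ≤
      (gradedPart πC i).map (LinearMap.mulLeft ℝ (ω ^ (D - 2 * i))) := by
    refine (gradedPart_join_le hα hβ _).trans (Finset.sup_le ?_)
    rintro ⟨u, v⟩ huv
    rw [Finset.HasAntidiagonal.mem_antidiagonal] at huv
    simp only at huv ⊢
    rcases lt_or_ge K.rank u with hu | hu
    · rw [hA.gradedPart_eq_bot_of_rank_lt hu, Submodule.map_bot, Submodule.bot_mul]
      exact bot_le
    rcases lt_or_ge L.rank v with hv | hv
    · rw [hB.gradedPart_eq_bot_of_rank_lt hv, Submodule.map_bot, Submodule.mul_bot]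
      exact bot_le
    refine (mul_le_mul'
      (Submodule.map_mono (hωK.gradedPart_le_span_strings hA hu))
      (Submodule.map_mono (hωL.gradedPart_le_span_strings hB hv))).trans ?_
    rw [Submodule.map_span, Submodule.map_span, Submodule.span_mul_span, Submodule.span_le]
    rintro _ ⟨_, ⟨_, ⟨a, j, p, haj, hua, hp, hp0, rfl⟩, rfl⟩,
      _, ⟨_, ⟨b, l, q, hbl, hvb, hq, hq0, rfl⟩, rfl⟩, rfl⟩
    -- A primitive element of degree `a` starts a string with `μ = K.rank - 2 * a`, and similarly
    -- for `b`. Since `a + j + b + l = D - i`, the product has weight `2 * (j + l) - μ - ν = D - 2 *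
    -- i`, exactly the required exponent.
    obtain ⟨y, hy, hyx⟩ := string_mul_mem (α (πA ωK)) (β (πB ωL)) (α p) (β q)
      (K.rank - 2 * a) (L.rank - 2 * b) (by rw [← map_pow, ← map_mul, hp0, map_zero])
      (by rw [← map_pow, ← map_mul, hq0, map_zero]) (gradedPart πC i) j l (D - 2 * i)
      (by omega) (by omega) (by omega) (fun a' b' hab => by
        have h1 := mul_mem_gradedPart
          (pow_mem_gradedPart (map_mem_gradedPart πA hωK.1) a') hp
        have h2 := mul_mem_gradedPart
          (pow_mem_gradedPart (map_mem_gradedPart πB hωL.1) b') hq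
        have h3 := mul_mem_gradedPart (hαm h1) (hβm h2)
        rwa [show a' + a + (b' + b) = i by omega, map_mul, map_mul, map_pow, map_pow,
          mul_mul_mul_comm] at h3)
    refine ⟨y, hy, ?_⟩
    rw [LinearMap.mulLeft_apply, hωst, ← hyx]
    simp only [AlgHom.toLinearMap_apply, map_mul, map_pow]
    ring
  -- Equal dimensions upgrade surjectivity to bijectivity.
  have hrank : Module.finrank ℝ (gradedPart πC i) = Module.finrank ℝ (gradedPart πC (D - i)) := by
    have hr : Polynomial.reflect D ((K.join L).hilbertPoly πC) = (K.join L).hilbertPoly πC := by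
      rw [hA.hilbertPoly_join hB hC, hDr, Polynomial.reflect_mul _ _ natDegree_hilbertPoly_le
        natDegree_hilbertPoly_le, hωK.reflect_hilbertPoly hA, hωL.reflect_hilbertPoly hB]
    rw [← hC.coeff_hilbertPoly, ← hC.coeff_hilbertPoly, ← Polynomial.revAt_le (by omega : i ≤ D),
      ← Polynomial.coeff_reflect, hr]
  have hrs : Function.Surjective ((LinearMap.mulLeft ℝ (ω ^ (D - 2 * i))).restrict hmaps) := by
    rintro ⟨y, hy⟩
    obtain ⟨x, hx, rfl⟩ := hsurj hy
    exact ⟨⟨x, hx⟩, rfl⟩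
  have hri := (LinearMap.injective_iff_surjective_of_finrank_eq_finrank hrank).mpr hrs
  refine ⟨hmaps, fun x hx y hy hxy => ?_, fun y hy => hsurj hy⟩
  exact congrArg Subtype.val (@hri ⟨x, hx⟩ ⟨y, hy⟩ (Subtype.ext hxy))

end Join

end PreAbstractSimplicialComplex

theorem mainTheorem1 (k : Type*) [CommRing k] [IsDomain k]
    {V W : Type*} [Finite V] [LinearOrder V] [Finite W] [LinearOrder W]
    (K : PreAbstractSimplicialComplex V) (L : PreAbstractSimplicialComplex W)
    (hK : K.IsGorensteinStar k) (hL : L.IsGorensteinStar k)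
    (dK dL : ℕ) (hdK : K.dim = (dK : ℤ) - 1) (hdL : L.dim = (dL : ℤ) - 1)
    (ΘK : Fin dK → MvPolynomial V ℝ) (ΘL : Fin dL → MvPolynomial W ℝ)
    (hΘK : K.IsLSOP ΘK) (hΘL : L.IsLSOP ΘL)
    (ωK : MvPolynomial V ℝ) (ωL : MvPolynomial W ℝ)
    (hωK : K.IsHLElement ΘK ωK) (hωL : L.IsHLElement ΘL ωL) :
    ((K.join L).HasSymmetricHVector ∧ (K.join L).dim = (dK : ℤ) + (dL : ℤ) - 1) ∧
    (K.join L).IsLSOP (joinTheta ΘK ΘL) ∧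
    (K.join L).IsHLElement (joinTheta ΘK ΘL)
      (MvPolynomial.rename Sum.inl ωK + MvPolynomial.rename Sum.inr ωL) := by
  have hrK : K.rank = dK := by
    simp only [PreAbstractSimplicialComplex.dim] at hdK
    omega
  have hrL : L.rank = dL := by
    simp only [PreAbstractSimplicialComplex.dim] at hdL
    omega
  have hr : (K.join L).rank = dK + dL := by
    rw [PreAbstractSimplicialComplex.rank_join, hrK, hrL]
  have hΘ := PreAbstractSimplicialComplex.isHomogeneous_joinTheta hΘK.1 hΘL.1
  have hA := K.isFaceQuotient_proj hΘK.1
  have hB := L.isFaceQuotient_proj hΘL.1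
  have hC := (K.join L).isFaceQuotient_proj hΘ
  have hfA : Module.Finite ℝ (K.H ΘK) := hΘK.2.2.2
  have hfB : Module.Finite ℝ (L.H ΘL) := hΘL.2.2.2
  refine ⟨⟨hK.hasSymmetricHVector_join k hL, ?_⟩, ⟨hΘ, inferInstance, ?_, ?_⟩, ?_⟩
  · rw [PreAbstractSimplicialComplex.dim, hr]
    push_cast
    ring
  · rw [hr, Nat.card_eq_fintype_card, Fintype.card_sum, Fintype.card_fin, Fintype.card_fin]
  · exact hA.finite_join hB hC
  -- `IsHLElement` unfolds to `IsLefschetz` for the presentation `proj`.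
  · exact PreAbstractSimplicialComplex.IsLefschetz.join hA hB hC hωK hωL
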